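/- Let $0<\varepsilon<1$, $n\in\mathbb N$, $m=\lfloor(1-\varepsilon)n\rfloor$ (so $m=(1-\varepsilon)n$ when this is an integer) and $L\ge 1$. Let $A=(a_{ij})$ be the random $m\times(n+L-1)$ matrix over $\mathbb F_2$ in which, independently for each row $i$, a starting position $s_i\in\{1,\dots,n\}$ is chosen uniformly at random, the entries $a_{ij}$ with $s_i\le j<s_i+L$ (the block of row $i$) are independent fair random bits, and all other entries of the row are $0$. Algorithm SGAUSS, on input $A$, $(s_i)$ and $\vec b\in\mathbb F_2^m$, sorts the rows of the system $(A,\vec b)$ so that $s_1\le\dots\le s_m$ (equal values stay in their original order). Then for $i=1,\dots,m$ it looks for the leftmost $j\in\{s_i,\dots,s_i+L-1\}$ with $a_{ij}=1$. If there is none, it stops with FAILURE. Otherwise it sets $\mathrm{piv}_i=j$ and, for each $i'>i$ with $s_{i'}\le \mathrm{piv}_i$ and $a_{i',\mathrm{piv}_i}=1$, performs a row addition: it adds row $i$ to row $i'$ and $b_i$ to $b_{i'}$. If no failure occurs, the algorithm succeeds: it starts with $\vec z=\vec 0$, sets $z_{\mathrm{piv}_i}\leftarrow\langle\vec z,a_i\rangle+b_i$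 for $i=m,\dots,1$, and returns $\vec z$. There are an absolute constant $C>0$, a function $T:\mathbb R\to\mathbb R$ and a fixed word RAM program $P$ such that for every $\varepsilon\in(0,1)$ there is an $m_0=m_0(\varepsilon)$ with the following property. For every $m\ge m_0$ there is an integer $L\ge 1$ with $L\le C(\log m)/\varepsilon$ such that for all $n$ with $m=\lfloor(1-\varepsilon)n\rfloor$ and every right-hand side $\vec b\in\mathbb F_2^m$: (i) SGAUSS succeeds with probability at least $1-C/m$. It succeeds if and only if $A$ has full row rank $m$, and in that case the returned vector satisfies $A\vec z=\vec b$. (ii) The expected number of row additions performed by SGAUSS (counted in successful and unsuccessful runs) is at most $C\,m/\varepsilon$. (iii) At each row addition, the nonzero entries of every row lie in the block of that row, and the nonzero entries of the row that is added lie in the block of the row to which it is added. For every $c>0$, on a word RAM with unit-cost operations on words of $w\ge c\log m$ bits, $P$ performs each row addition in at most $T(c)/\varepsilon$ steps. Here each row is stored as its starting position, its right-hand side bit and its block packed into $\lceil L/w\rceil$ consecutive words; the program is given the addresses of the two rows and the numbers $\lceil L/w\rceil$ and $w$, and changes no memory outside the record of the row to which it adds. -/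

import Mathlib

open scoped BigOperators Matrix

/-! ## The solver -/

namespace SGauss

/-- A single row addition: the system `(A, b)` at the moment of the addition,
the row `src` that is added and the row `dst` to which it is added. -/
structure RowAddition (m N : ℕ) where
  A : Matrix (Fin m) (Fin N) (ZMod 2)
  b : Fin m → ZMod 2
  src : Fin m
  dst : Fin m

/-- The matrix after the row addition. -/
def RowAddition.newA {m N : ℕ} (e : RowAddition m N) : Matrix (Fin m) (Fin N) (ZMod 2) :=
  Function.update e.A e.dst (e.A e.dst + e.A e.src)

/-- The right hand side after the row addition. -/
def RowAddition.newb {m N : ℕ} (e : RowAddition m N) : Fin m → ZMod 2 :=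
  Function.update e.b e.dst (e.b e.dst + e.b e.src)

/-- State of the elimination phase; `adds` lists the row additions made so far,
in chronological order. -/
structure State (m N : ℕ) where
  A : Matrix (Fin m) (Fin N) (ZMod 2)
  b : Fin m → ZMod 2
  piv : Fin m → Option (Fin N)
  failed : Bool
  adds : List (RowAddition m N)

/-- `a_{i'} ← a_{i'} + a_i` and `b_{i'} ← b_{i'} + b_i`. -/
def addRow {m N : ℕ} (st : State m N) (i i' : Fin m) : State m N :=
  let e : RowAddition m N := ⟨st.A, st.b, i, i'⟩
  { st with A := e.newA, b := e.newb, adds := st.adds ++ [e] }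

/-- The leftmost column `j` among `s_i, …, s_i + L - 1` with `a_{ij} = 1`, if there is one. -/
def findPivot {m N : ℕ} (L : ℕ) (s : Fin m → ℕ) (A : Matrix (Fin m) (Fin N) (ZMod 2))
    (i : Fin m) : Option (Fin N) :=
  (List.finRange N).find? fun j =>
    decide (s i ≤ (j : ℕ)) && decide ((j : ℕ) < s i + L) && decide (A i j = 1)

/-- The loop over all `i'` with `i' > i` and `s_{i'} ≤ j`, where `j` is the pivot of row `i`:
row `i` is added to row `i'` if `a_{i'j} = 1`. -/
def eliminate {m N : ℕ} (s : Fin m → ℕ) (st : State m N) (i : Fin m) (j : Fin N) : State m N :=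
  (List.finRange m).foldl
    (fun st i' => if i < i' ∧ s i' ≤ (j : ℕ) ∧ st.A i' j = 1 then addRow st i i' else st) st

/-- The round for row `i`. Once the algorithm has failed, nothing happens any more. -/
def round {m N : ℕ} (L : ℕ) (s : Fin m → ℕ) (st : State m N) (i : Fin m) : State m N :=
  if st.failed then st
  else
    match findPivot L s st.A i with
    | none => { st with failed := true }
    | some j => eliminate s { st with piv := Function.update st.piv i (some j) } i j

/-- The elimination phase, on a system whose rows are sorted by starting position. -/
def eliminationPhase {m N : ℕ} (L : ℕ) (s : Fin m → ℕ) (A : Matrix (Fin m) (Fin N) (ZMod 2))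
    (b : Fin m → ZMod 2) : State m N :=
  (List.finRange m).foldl (round L s) ⟨A, b, fun _ => none, false, []⟩

/-- Back substitution: for `i = m, …, 1`, set `z_{piv_i} ← ⟨z, a_i⟩ + b_i`, starting with `z = 0`. -/
def backSubst {m N : ℕ} (st : State m N) : Fin N → ZMod 2 :=
  (List.finRange m).reverse.foldl
    (fun z i =>
      match st.piv i with
      | none => z
      | some j => Function.update z j (z ⬝ᵥ st.A i + st.b i)) 0

/-- The starting positions in sorted order (ties are broken by the original row index). -/
def sortedStarts {m : ℕ} (s : Fin m → ℕ) : Fin m → ℕ := s ∘ Tuple.sort s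

/-- The state after the sorting and the elimination phase. -/
def finalState {m N : ℕ} (L : ℕ) (s : Fin m → ℕ) (A : Matrix (Fin m) (Fin N) (ZMod 2))
    (b : Fin m → ZMod 2) : State m N :=
  eliminationPhase L (sortedStarts s) (fun i => A (Tuple.sort s i)) (fun i => b (Tuple.sort s i))

/-- The value returned by the solver: `none` stands for failure. -/
def sgauss {m N : ℕ} (L : ℕ) (s : Fin m → ℕ) (A : Matrix (Fin m) (Fin N) (ZMod 2))
    (b : Fin m → ZMod 2) : Option (Fin N → ZMod 2) :=
  let st := finalState L s A b
  if st.failed then none else some (backSubst st)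

/-- The row additions made in a (successful or unsuccessful) run of the solver, in chronological
order. The rows are numbered in sorted order. -/
def rowAdditions {m N : ℕ} (L : ℕ) (s : Fin m → ℕ) (A : Matrix (Fin m) (Fin N) (ZMod 2))
    (b : Fin m → ZMod 2) : List (RowAddition m N) :=
  (finalState L s A b).adds

/-! ## The random matrix -/

/-- The sample space: for each of the `m` rows a starting position in `{0, …, n - 1}` and the `L`
bits of the block. The random matrix is given by the uniform distribution on it, that is, all
starting positions are uniform, all bits are fair, and all of them are independent. -/
abbrev Sample (m n L : ℕ) : Type := Fin m → Fin n × (Fin L → ZMod 2)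

/-- The starting positions. -/
def starts {m n L : ℕ} (ω : Sample m n L) : Fin m → ℕ := fun i => (ω i).1

/-- The `m × (n + L - 1)` matrix: row `i` holds its block in the columns
`s_i, …, s_i + L - 1`, and `0` elsewhere. -/
def bandMatrix {m n L : ℕ} (ω : Sample m n L) : Matrix (Fin m) (Fin (n + L - 1)) (ZMod 2) :=
  fun i j =>
    if h : starts ω i ≤ (j : ℕ) ∧ (j : ℕ) - starts ω i < L then (ω i).2 ⟨j - starts ω i, h.2⟩ else 0

open Classical in
/-- Probability of the event `E` under the uniform distribution on a finite type. -/
noncomputable def unifProb {Ω : Type} [Fintype Ω] (E : Ω → Prop) : ℝ :=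
  ((Finset.univ.filter E).card : ℝ) / (Fintype.card Ω : ℝ)

/-- Expectation of `X` under the uniform distribution on a finite type. -/
noncomputable def unifExpect {Ω : Type} [Fintype Ω] (X : Ω → ℝ) : ℝ :=
  (∑ ω, X ω) / (Fintype.card Ω : ℝ)

end SGauss

/-! ## The word RAM -/

namespace WordRAM

/-- Binary word operations. -/
inductive BinOp
  | add | sub | and | or | xor | shl | shr

/-- Instructions. All arguments are register numbers, except the literal `c` and the jump
target `l`. Every instruction takes one unit of time. -/
inductive Instr
  | const (d c : ℕ)
  | move (d a : ℕ)
  | not (d a : ℕ)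
  | parity (d a : ℕ)
  | bin (op : BinOp) (d a b : ℕ)
  | load (d a : ℕ)
  | store (a v : ℕ)
  | jump (l : ℕ)
  | jumpZero (a l : ℕ)
  | jumpLt (a b l : ℕ)

/-- A program; it halts when the program counter leaves the list. -/
abbrev Program : Type := List Instr

/-- A machine with `w`-bit words: registers, and a memory of `2 ^ w` words. -/
structure State (w : ℕ) where
  pc : ℕ
  reg : ℕ → BitVec w
  mem : BitVec w → BitVec w

/-- Shifts by `w` or more positions yield `0`; arithmetic is modulo `2 ^ w`. -/
def BinOp.eval {w : ℕ} : BinOp → BitVec w → BitVec w → BitVec w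
  | .add, x, y => x + y
  | .sub, x, y => x - y
  | .and, x, y => x &&& y
  | .or, x, y => x ||| y
  | .xor, x, y => x ^^^ y
  | .shl, x, y => x <<< y.toNat
  | .shr, x, y => x >>> y.toNat

/-- The parity of the number of ones in a word. -/
def parity {w : ℕ} (x : BitVec w) : BitVec w :=
  BitVec.ofNat w (((Finset.range w).filter fun t => x.getLsbD t = true).card % 2)

/-- Write `v` to register `d` and proceed to the next instruction. -/
def State.setReg {w : ℕ} (σ : State w) (d : ℕ) (v : BitVec w) : State w :=
  { σ with pc := σ.pc + 1, reg := Function.update σ.reg d v }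

/-- Effect of an instruction. -/
def Instr.exec {w : ℕ} (σ : State w) : Instr → State w
  | .const d c => σ.setReg d (BitVec.ofNat w c)
  | .move d a => σ.setReg d (σ.reg a)
  | .not d a => σ.setReg d (~~~ σ.reg a)
  | .parity d a => σ.setReg d (WordRAM.parity (σ.reg a))
  | .bin op d a b => σ.setReg d (op.eval (σ.reg a) (σ.reg b))
  | .load d a => σ.setReg d (σ.mem (σ.reg a))
  | .store a v => { σ with pc := σ.pc + 1, mem := Function.update σ.mem (σ.reg a) (σ.reg v) }
  | .jump l => { σ with pc := l }
  | .jumpZero a l => { σ with pc := if σ.reg a = 0 then l else σ.pc + 1 }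
  | .jumpLt a b l => { σ with pc := if (σ.reg a).toNat < (σ.reg b).toNat then l else σ.pc + 1 }

/-- One step; a halted machine does not change any more. -/
def step {w : ℕ} (P : Program) (σ : State w) : State w :=
  match P[σ.pc]? with
  | none => σ
  | some I => I.exec σ

/-- Started in `σ`, the program halts in the state `τ` after `t` steps. -/
def HaltsIn {w : ℕ} (P : Program) (σ : State w) (t : ℕ) (τ : State w) : Prop :=
  (step P)^[t] σ = τ ∧ (∀ t' < t, ((step P)^[t'] σ).pc < P.length) ∧ P.length ≤ τ.pc

/-- The number `⌈L / w⌉` of words needed for a block of `L` bits. -/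
def blockWords (L w : ℕ) : ℕ := (L + w - 1) / w

/-- The rows are kept in pairwise disjoint records of `blockWords L w + 2` consecutive words;
`addr i` is the address of the first word of the record of row `i`. -/
structure IsLayout (w L : ℕ) {m : ℕ} (addr : Fin m → ℕ) : Prop where
  fits : ∀ i, addr i + (blockWords L w + 2) ≤ 2 ^ w
  disjoint : ∀ i i', i ≠ i' →
    addr i + (blockWords L w + 2) ≤ addr i' ∨ addr i' + (blockWords L w + 2) ≤ addr i

/-- The memory holds the system `(A, b)` with starting positions `s`: the record of row `i`
consists of the starting position `s_i`, the bit `b_i`, and the entries of row `i` in the columns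
`s_i, …, s_i + L - 1`, packed into words (least significant bit first) and padded with zeros. -/
structure Stores {w m N : ℕ} (L : ℕ) (addr : Fin m → ℕ) (s : Fin m → ℕ)
    (A : Matrix (Fin m) (Fin N) (ZMod 2)) (b : Fin m → ZMod 2) (mem : BitVec w → BitVec w) :
    Prop where
  start : ∀ i, (mem (BitVec.ofNat w (addr i))).toNat = s i
  rhs : ∀ i, mem (BitVec.ofNat w (addr i + 1)) = BitVec.ofNat w (b i).val
  block : ∀ i, ∀ k < blockWords L w, ∀ t < w,
    ((mem (BitVec.ofNat w (addr i + 2 + k))).getLsbD t = true ↔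
      k * w + t < L ∧ ∃ j : Fin N, (j : ℕ) = s i + (k * w + t) ∧ A i j = 1)

/-- The program `P` performs the row addition `e` in at most `T` steps on machines with `w`-bit
words, for rows with starting positions `s` and blocks of length `L`: whenever the memory holds the
system before the addition, and the registers `0, 1, 2, 3` hold the addresses of the two rows, the
number of words per block and the word length, `P` halts after at most `T` steps, the memory then
holds the system after the addition, and nothing outside the record of row `dst` has changed. -/
def PerformsRowAddition (P : Program) (w L : ℕ) {m N : ℕ} (s : Fin m → ℕ)
    (e : SGauss.RowAddition m N) (T : ℝ) : Prop :=
  ∀ addr : Fin m → ℕ, IsLayout w L addr →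
    ∀ σ : State w, σ.pc = 0 →
      σ.reg 0 = BitVec.ofNat w (addr e.src) →
      σ.reg 1 = BitVec.ofNat w (addr e.dst) →
      σ.reg 2 = BitVec.ofNat w (blockWords L w) →
      σ.reg 3 = BitVec.ofNat w w →
      Stores L addr s e.A e.b σ.mem →
      ∃ (t : ℕ) (τ : State w), (t : ℝ) ≤ T ∧ HaltsIn P σ t τ ∧
        Stores L addr s e.newA e.newb τ.mem ∧
        ∀ x : BitVec w,
          (x.toNat < addr e.dst ∨ addr e.dst + (blockWords L w + 2) ≤ x.toNat) → τ.mem x = σ.mem x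

end WordRAM

/-! A row is added only to a later row, and only if its pivot is not left of that row's block.
Blocks are sorted by start and have equal length, so no row ever leaves its block (`ElimInv.block`).
Elimination multiplies the sorted system by a unit lower triangular matrix and leaves zeros below
every pivot, so a zero row turns up exactly when the rows of A are dependent; correctness is then
linear algebra (`RoundInv`).

Both probabilistic bounds count dependencies. If the blocks of a combination of rows cover the
columns [p, q), each of these columns contains a free random bit, so the combination vanishes there
with probability at most 2^(-(q-p)) (`card_vanishing_mul_le`). If X rows start in the interval
considered, there are at most 2^X combinations. A dependency of the whole matrix contains one whose
rows start within y consecutive positions while their blocks cover y + L - 1 columns. As X has mean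
at most (1-ε)y, a Chernoff bound with exponent ε/2 gives exp(-ε(L-1)/2) for each of the n² choices
of p and y, in total at most 1/m for L about 20 log m / ε.

Row i' receives additions only from earlier rows whose pivot is at or right of j = s_{i'}. If there
are r of them, they span 2^r combinations of original rows that vanish left of j
(`two_pow_pendingRows_le`). When A has independent rows, such a combination is an arbitrary set of
rows starting at j plus a combination covering some [p, j) and vanishing there
(`card_prefixKernel_le`). For fixed starts the expected number of the latter is at most 2^(backlog +
4/ε), where the backlog is that of a queue with service rate 1 - ε/2, fed by the starting rows. So,
averaged over the bits, r is bounded by arrivals + backlog + 4/ε + 1. The drift of the squared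
backlog shows that the average over positions is O(1/ε), and a random row sees no more than this
average (`unifExpect_sum_arrivals_mul_le`). Runs on dependent rows make at most m² additions and
have probability at most 1/m.

On the word RAM a row addition xors one block, shifted by the difference of the starts, into the
other: O(1 + L/w) word operations, which is O(1/ε) when w is of order log m. -/

namespace SGauss

/-! ### Folding over `Fin m` -/

theorem foldl_finRange_induction {β : Type*} {m : ℕ} (f : β → Fin m → β) (P : ℕ → β → Prop) (b : β)
    (h0 : P 0 b) (hs : ∀ (k : Fin m) x, P k x → P (k + 1) (f x k)) :
    P m ((List.finRange m).foldl f b) := by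
  induction m with
  | zero => simpa using h0
  | succ m ih =>
    rw [List.finRange_succ_last, List.foldl_append, List.foldl_map]
    exact hs (Fin.last m) _ (ih _ fun k x hx => hs k.castSucc x hx)

theorem foldl_finRange_reverse_induction {β : Type*} {m : ℕ} (f : β → Fin m → β) (P : ℕ → β → Prop)
    (b : β) (h0 : P m b) (hs : ∀ (k : Fin m) x, P (k + 1) x → P k (f x k)) :
    P 0 ((List.finRange m).reverse.foldl f b) := by
  induction m generalizing b with
  | zero => simpa using h0
  | succ m ih =>
    rw [List.finRange_succ_last, List.reverse_append, List.foldl_append, ← List.map_reverse,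
      List.foldl_map]
    exact ih _ _ (hs (Fin.last m) _ h0) fun k x hx => hs k.castSucc x hx

theorem zmod_two_eq_one {x : ZMod 2} (h : x ≠ 0) : x = 1 := by
  revert x; decide

theorem zmod_two_add_self (x : ZMod 2) : x + x = 0 := by
  revert x; decide

/-! ### The elimination phase -/

/-- The nonzero entries of every row lie in the block of that row. -/
def BlockSupported {m N : ℕ} (L : ℕ) (s : Fin m → ℕ) (A : Matrix (Fin m) (Fin N) (ZMod 2)) : Prop :=
  ∀ i j, A i j ≠ 0 → s i ≤ (j : ℕ) ∧ (j : ℕ) < s i + L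

theorem RowAddition.newA_dst {m N : ℕ} (e : RowAddition m N) :
    e.newA e.dst = e.A e.dst + e.A e.src :=
  Function.update_self (β := fun _ => Fin N → ZMod 2) _ _ _

theorem RowAddition.newA_of_ne {m N : ℕ} (e : RowAddition m N) {i : Fin m} (h : i ≠ e.dst) :
    e.newA i = e.A i :=
  Function.update_of_ne (β := fun _ => Fin N → ZMod 2) h _ _

theorem RowAddition.newb_dst {m N : ℕ} (e : RowAddition m N) :
    e.newb e.dst = e.b e.dst + e.b e.src :=
  Function.update_self _ _ _

theorem RowAddition.newb_of_ne {m N : ℕ} (e : RowAddition m N) {i : Fin m} (h : i ≠ e.dst) :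
    e.newb i = e.b i :=
  Function.update_of_ne h _ _

/-- The properties of a row addition made by the elimination phase. -/
structure RowAddition.Good {m N : ℕ} (L : ℕ) (s : Fin m → ℕ) (e : RowAddition m N) : Prop where
  block : BlockSupported L s e.A
  ne : e.src ≠ e.dst
  le : s e.src ≤ s e.dst
  fits : ∀ j, e.A e.src j ≠ 0 → s e.dst ≤ (j : ℕ)
  nonzero : ∃ j, e.A e.src j ≠ 0

theorem RowAddition.Good.mem_block {m N : ℕ} {L : ℕ} {s : Fin m → ℕ} {e : RowAddition m N}
    (h : e.Good L s) (j : Fin N) (hj : e.A e.src j ≠ 0) :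
    s e.dst ≤ (j : ℕ) ∧ (j : ℕ) < s e.dst + L :=
  ⟨h.fits j hj, (h.block _ _ hj).2.trans_le (Nat.add_le_add_right h.le L)⟩

/-- A nonzero entry of the added row lies in both blocks, so these overlap. This keeps the number of
skipped source words below the number of words in a block. -/
theorem RowAddition.Good.shift_lt {m N : ℕ} {L : ℕ} {s : Fin m → ℕ} {e : RowAddition m N}
    (h : e.Good L s) : s e.dst - s e.src < L := by
  obtain ⟨j, hj⟩ := h.nonzero
  have h1 := h.fits j hj
  have h2 := h.block _ _ hj
  omega

theorem findPivot_eq_none {m N : ℕ} {L : ℕ} {s : Fin m → ℕ} {A : Matrix (Fin m) (Fin N) (ZMod 2)}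
    (hA : BlockSupported L s A) {i : Fin m} (h : findPivot L s A i = none) : A i = 0 := by
  funext j
  by_contra hj
  have h1 := hA i j hj
  have := List.find?_eq_none.1 h j (List.mem_finRange j)
  simp [h1.1, h1.2, zmod_two_eq_one hj] at this

theorem findPivot_eq_some {m N : ℕ} {L : ℕ} {s : Fin m → ℕ} {A : Matrix (Fin m) (Fin N) (ZMod 2)}
    (hA : BlockSupported L s A) {i : Fin m} {j : Fin N} (h : findPivot L s A i = some j) :
    A i j = 1 ∧ ∀ c < j, A i c = 0 := by
  rw [findPivot, List.find?_eq_some_iff_getElem] at h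
  obtain ⟨h1, k, hk, hkj, hlt⟩ := h
  simp only [Bool.and_eq_true, decide_eq_true_eq] at h1
  refine ⟨h1.2, fun c hc => ?_⟩
  by_contra hne
  have h2 := hA i c hne
  have hjk : (j : ℕ) = k := by rw [← hkj]; simp
  have := hlt c (by rw [← hjk]; exact hc)
  simp [h2.1, h2.2, zmod_two_eq_one hne] at this

/-- The system after the first `t` steps of the loop `eliminate`. -/
structure ElimInv {m N : ℕ} (L : ℕ) (s : Fin m → ℕ) (st₀ : State m N) (i : Fin m) (j : Fin N)
    (t : ℕ) (st : State m N) : Prop where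
  rowA : ∀ i', st.A i' = if (i' : ℕ) < t ∧ i < i' ∧ s i' ≤ (j : ℕ) ∧ st₀.A i' j = 1
    then st₀.A i' + st₀.A i else st₀.A i'
  rowb : ∀ i', st.b i' = if (i' : ℕ) < t ∧ i < i' ∧ s i' ≤ (j : ℕ) ∧ st₀.A i' j = 1
    then st₀.b i' + st₀.b i else st₀.b i'
  piv : st.piv = st₀.piv
  failed : st.failed = st₀.failed
  good : ∀ e ∈ st.adds, e.Good L s
  len : st.adds.length ≤ st₀.adds.length +
    (Finset.univ.filter fun i' : Fin m => (i' : ℕ) < t ∧ i < i' ∧ s i' ≤ (j : ℕ)).card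

/-- The added row is zero left of its pivot `j`, and `j` is at or right of the target's start; since
`s i ≤ s i'`, its block also ends no later than the target's. -/
theorem ElimInv.block {m N : ℕ} {L : ℕ} {s : Fin m → ℕ} (hs : Monotone s) {st₀ : State m N}
    {i : Fin m} {j : Fin N} {t : ℕ} {st : State m N} (h : ElimInv L s st₀ i j t st)
    (hb : BlockSupported L s st₀.A) (hl : ∀ c < j, st₀.A i c = 0) : BlockSupported L s st.A := by
  intro i' c hc
  rw [h.rowA] at hc
  split_ifs at hc with hcond
  · obtain ⟨-, hlt, hsj, -⟩ := hcond
    by_cases h0 : st₀.A i' c = 0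
    · rw [Pi.add_apply, h0, zero_add] at hc
      have h1 := hb i c hc
      have h2 : j ≤ c := by
        by_contra hcj
        exact hc (hl c (not_le.1 hcj))
      have h3 : (j : ℕ) ≤ c := h2
      have := hs hlt.le
      omega
    · exact hb i' c h0
  · exact hb i' c hc

theorem eliminate_inv {m N : ℕ} {L : ℕ} {s : Fin m → ℕ} (hs : Monotone s) (st₀ : State m N)
    (i : Fin m) (j : Fin N) (hb : BlockSupported L s st₀.A) (h1 : st₀.A i j = 1)
    (hl : ∀ c < j, st₀.A i c = 0) (hg : ∀ e ∈ st₀.adds, e.Good L s) :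
    ElimInv L s st₀ i j m (eliminate s st₀ i j) := by
  refine foldl_finRange_induction _ (ElimInv L s st₀ i j) st₀ ?_ ?_
  · exact ⟨by simp, by simp, rfl, rfl, hg, by simp⟩
  · intro k st h
    -- Step `k` changes row `k` only. Hence both rows involved are still as they were before the
    -- loop, and the test on `st` is the test on `st₀`.
    have hk : st.A k = st₀.A k := by rw [h.rowA]; simp
    have hkb : st.b k = st₀.b k := by rw [h.rowb]; simp
    have hi : st.A i = st₀.A i := by rw [h.rowA]; simp
    have hib : st.b i = st₀.b i := by rw [h.rowb]; simp
    have hblock := h.block hs hb hl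
    have hcard : (Finset.univ.filter fun i' : Fin m =>
        (i' : ℕ) < k ∧ i < i' ∧ s i' ≤ (j : ℕ)).card ≤
        (Finset.univ.filter fun i' : Fin m => (i' : ℕ) < k + 1 ∧ i < i' ∧ s i' ≤ (j : ℕ)).card := by
      refine Finset.card_le_card fun x hx => ?_
      simp only [Finset.mem_filter, Finset.mem_univ, true_and] at hx ⊢
      exact ⟨by omega, hx.2⟩
    have aux : ∀ i' : Fin m, i' ≠ k → ((i' : ℕ) < k + 1 ↔ (i' : ℕ) < k) := by
      intro i' hne
      have : (i' : ℕ) ≠ k := fun hh => hne (Fin.ext hh)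
      omega
    split_ifs with hc
    · obtain ⟨hik, hsk, hAk⟩ := hc
      rw [hk] at hAk
      refine ⟨fun i' => ?_, fun i' => ?_, h.piv, h.failed, ?_, ?_⟩
      · by_cases hne : i' = k
        · subst hne
          rw [if_pos ⟨Nat.lt_succ_self _, hik, hsk, hAk⟩, ← hk, ← hi]
          exact RowAddition.newA_dst ⟨st.A, st.b, i, i'⟩
        · simp only [aux i' hne]
          rw [← h.rowA i']
          exact RowAddition.newA_of_ne ⟨st.A, st.b, i, k⟩ hne
      · by_cases hne : i' = k
        · subst hne
          rw [if_pos ⟨Nat.lt_succ_self _, hik, hsk, hAk⟩, ← hkb, ← hib]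
          exact RowAddition.newb_dst ⟨st.A, st.b, i, i'⟩
        · simp only [aux i' hne]
          rw [← h.rowb i']
          exact RowAddition.newb_of_ne ⟨st.A, st.b, i, k⟩ hne
      · intro e he
        simp only [addRow, List.mem_append, List.mem_singleton] at he
        rcases he with he | rfl
        · exact h.good e he
        · refine ⟨hblock, hik.ne, hs hik.le, fun c hc => ?_, j, ?_⟩
          · simp only [hi] at hc
            have : j ≤ c := by
              by_contra hcj
              exact hc (hl c (not_le.1 hcj))
            exact hsk.trans this
          · simp only [hi, h1]; decide
      · simp only [addRow, List.length_append, List.length_singleton]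
        have hlt : (Finset.univ.filter fun i' : Fin m =>
            (i' : ℕ) < k ∧ i < i' ∧ s i' ≤ (j : ℕ)).card <
            (Finset.univ.filter fun i' : Fin m =>
              (i' : ℕ) < k + 1 ∧ i < i' ∧ s i' ≤ (j : ℕ)).card := by
          refine Finset.card_lt_card ((Finset.ssubset_iff_of_subset fun x hx => ?_).2 ⟨k, ?_, ?_⟩)
          · simp only [Finset.mem_filter, Finset.mem_univ, true_and] at hx ⊢
            exact ⟨by omega, hx.2⟩
          · simp [hik, hsk]
          · simp
        have := h.len
        omega
    · rw [hk] at hc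
      refine ⟨fun i' => ?_, fun i' => ?_, h.piv, h.failed, h.good, h.len.trans (by omega)⟩
      · by_cases hne : i' = k
        · subst hne
          rw [hk, if_neg]
          exact fun hh => hc hh.2
        · simp only [aux i' hne]
          exact h.rowA i'
      · by_cases hne : i' = k
        · subst hne
          rw [hkb, if_neg]
          exact fun hh => hc hh.2
        · simp only [aux i' hne]
          exact h.rowb i'

/-- The invariant of the elimination phase: `k` is the number of completed rounds. -/
structure RoundInv {m N : ℕ} (L : ℕ) (s : Fin m → ℕ) (A₀ : Matrix (Fin m) (Fin N) (ZMod 2))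
    (b₀ : Fin m → ZMod 2) (k : ℕ) (st : State m N) : Prop where
  block : BlockSupported L s st.A
  trans : ∃ U : Matrix (Fin m) (Fin m) (ZMod 2), (∀ i i', i < i' → U i i' = 0) ∧
    (∀ i, U i i = 1) ∧ (∀ i, st.A i = U i ᵥ* A₀) ∧ ∀ i, st.b i = U i ⬝ᵥ b₀
  piv_lt : ∀ i j, st.piv i = some j → (i : ℕ) < k
  piv_one : ∀ i j, st.piv i = some j → st.A i j = 1
  piv_left : ∀ i j, st.piv i = some j → ∀ c < j, st.A i c = 0
  piv_below : ∀ i j, st.piv i = some j → ∀ i', i < i' → st.A i' j = 0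
  piv_some : st.failed = false → ∀ i : Fin m, (i : ℕ) < k → ∃ j, st.piv i = some j
  zero_row : st.failed = true → ∃ i, st.A i = 0
  good : ∀ e ∈ st.adds, e.Good L s
  len : st.adds.length ≤ ∑ i : Fin m, (Finset.univ.filter fun i' : Fin m =>
    i < i' ∧ ∃ j, st.piv i = some j ∧ s i' ≤ (j : ℕ)).card

theorem round_inv {m N : ℕ} {L : ℕ} {s : Fin m → ℕ} (hs : Monotone s)
    {A₀ : Matrix (Fin m) (Fin N) (ZMod 2)} {b₀ : Fin m → ZMod 2} (k : Fin m) (st : State m N)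
    (h : RoundInv L s A₀ b₀ k st) : RoundInv L s A₀ b₀ (k + 1) (round L s st k) := by
  unfold round
  split_ifs with hf
  · exact ⟨h.block, h.trans, fun i j hj => (h.piv_lt i j hj).trans (Nat.lt_succ_self _), h.piv_one,
      h.piv_left, h.piv_below, by simp [hf], h.zero_row, h.good, h.len⟩
  rw [Bool.not_eq_true] at hf
  split
  · rename_i hnone
    exact ⟨h.block, h.trans, fun i j hj => (h.piv_lt i j hj).trans (Nat.lt_succ_self _), h.piv_one,
      h.piv_left, h.piv_below, by simp, fun _ => ⟨k, findPivot_eq_none h.block hnone⟩, h.good,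
      h.len⟩
  · rename_i j hj
    obtain ⟨h1, hl⟩ := findPivot_eq_some h.block hj
    have hkpiv : ∀ j', st.piv k ≠ some j' := fun j' hj' => lt_irrefl _ (h.piv_lt k j' hj')
    have E := eliminate_inv hs { st with piv := Function.update st.piv k (some j) } k j h.block h1 hl
      h.good
    set st' := eliminate s { st with piv := Function.update st.piv k (some j) } k j with hst'
    have hA : ∀ i', st'.A i' = if k < i' ∧ s i' ≤ (j : ℕ) ∧ st.A i' j = 1
        then st.A i' + st.A k else st.A i' := fun i' => by
      rw [E.rowA]; simp [i'.2]
    have hB : ∀ i', st'.b i' = if k < i' ∧ s i' ≤ (j : ℕ) ∧ st.A i' j = 1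
        then st.b i' + st.b k else st.b i' := fun i' => by
      rw [E.rowb]; simp [i'.2]
    have hle : ∀ i' : Fin m, i' ≤ k → st'.A i' = st.A i' := fun i' hi' => by
      rw [hA, if_neg]; exact fun hh => absurd hh.1 (not_lt.2 hi')
    have hpiv : ∀ i j', st'.piv i = some j' → (i = k ∧ j' = j) ∨ (i < k ∧ st.piv i = some j') := by
      intro i j' hij
      rw [E.piv] at hij
      by_cases hik : i = k
      · subst hik; simp at hij; exact Or.inl ⟨rfl, hij.symm⟩
      · simp only [Function.update_of_ne hik] at hij
        exact Or.inr ⟨h.piv_lt i j' hij, hij⟩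
    refine ⟨E.block hs h.block hl, ?_, ?_, ?_, ?_, ?_, ?_, ?_, E.good, ?_⟩
    · obtain ⟨U, hU0, hU1, hUA, hUb⟩ := h.trans
      refine ⟨fun i' => if k < i' ∧ s i' ≤ (j : ℕ) ∧ st.A i' j = 1 then U i' + U k else U i',
        fun i i' hii' => ?_, fun i => ?_, fun i => ?_, fun i => ?_⟩
      · dsimp only
        split_ifs with hc
        · rw [Pi.add_apply, hU0 _ _ hii', hU0 _ _ (hc.1.trans hii'), add_zero]
        · exact hU0 _ _ hii'
      · dsimp only
        split_ifs with hc
        · rw [Pi.add_apply, hU1, hU0 _ _ hc.1, add_zero]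
        · exact hU1 i
      · rw [hA]
        dsimp only
        split_ifs with hc
        · rw [Matrix.add_vecMul, hUA i, hUA k]
        · exact hUA i
      · rw [hB]
        dsimp only
        split_ifs with hc
        · rw [add_dotProduct, hUb i, hUb k]
        · exact hUb i
    · intro i j' hij
      rcases hpiv i j' hij with ⟨rfl, -⟩ | ⟨hlt, -⟩
      · exact Nat.lt_succ_self _
      · exact Nat.lt_succ_of_lt hlt
    · intro i j' hij
      rcases hpiv i j' hij with ⟨rfl, rfl⟩ | ⟨hlt, hp⟩
      · rw [hle _ le_rfl, h1]
      · rw [hle _ hlt.le, h.piv_one i j' hp]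
    · intro i j' hij
      rcases hpiv i j' hij with ⟨rfl, rfl⟩ | ⟨hlt, hp⟩
      · rw [hle _ le_rfl]; exact hl
      · rw [hle _ hlt.le]; exact h.piv_left i j' hp
    · intro i j' hij i' hii'
      rcases hpiv i j' hij with ⟨rfl, rfl⟩ | ⟨hlt, hp⟩
      · rw [hA]
        split_ifs with hc
        · rw [Pi.add_apply, hc.2.2, h1, zmod_two_add_self]
        -- A row skipped by the loop has a zero in column `j`: a nonzero entry there would put `j`
        -- into its block, and both loop conditions would hold.
        · by_contra hne
          exact hc ⟨hii', (h.block _ _ hne).1, zmod_two_eq_one hne⟩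
      · rw [hA]
        split_ifs with hc
        · rw [Pi.add_apply, h.piv_below i j' hp i' hii', h.piv_below i j' hp k hlt, add_zero]
        · exact h.piv_below i j' hp i' hii'
    · intro _ i hi
      rw [E.piv]
      by_cases hik : i = k
      · exact ⟨j, by simp [hik]⟩
      · simp only [Function.update_of_ne hik]
        have : (i : ℕ) ≠ k := fun hh => hik (Fin.ext hh)
        exact h.piv_some hf i (by omega)
    · intro hf'
      rw [E.failed] at hf'
      simp [hf] at hf'
    · have hlen := E.len
      -- Row `k` had no pivot before this round, so its term in the bound rises from 0 to the number
      -- of additions allowed in this round.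
      have h0 : (Finset.univ.filter fun i' : Fin m =>
          k < i' ∧ ∃ j, st.piv k = some j ∧ s i' ≤ (j : ℕ)).card = 0 := by
        rw [Finset.card_eq_zero, Finset.filter_eq_empty_iff]
        rintro i' - ⟨-, j', hj', -⟩
        exact hkpiv j' hj'
      have hkk : (Finset.univ.filter fun i' : Fin m =>
          (i' : ℕ) < m ∧ k < i' ∧ s i' ≤ (j : ℕ)).card = (Finset.univ.filter fun i' : Fin m =>
          k < i' ∧ ∃ j, st'.piv k = some j ∧ s i' ≤ (j : ℕ)).card := by
        congr 1
        ext i'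
        simp [E.piv]
      have hrest : ∑ i ∈ Finset.univ.erase k, (Finset.univ.filter fun i' : Fin m =>
          i < i' ∧ ∃ j, st.piv i = some j ∧ s i' ≤ (j : ℕ)).card =
          ∑ i ∈ Finset.univ.erase k, (Finset.univ.filter fun i' : Fin m =>
          i < i' ∧ ∃ j, st'.piv i = some j ∧ s i' ≤ (j : ℕ)).card := by
        refine Finset.sum_congr rfl fun i hi => ?_
        rw [E.piv]
        simp only [Function.update_of_ne (Finset.ne_of_mem_erase hi)]
      have hold := h.len
      rw [← Finset.add_sum_erase _ _ (Finset.mem_univ k), h0, hrest] at hold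
      rw [← Finset.add_sum_erase _ _ (Finset.mem_univ k), ← hkk]
      simp only at hlen
      omega

theorem eliminationPhase_inv {m N : ℕ} {L : ℕ} {s : Fin m → ℕ} (hs : Monotone s)
    (A₀ : Matrix (Fin m) (Fin N) (ZMod 2)) (b₀ : Fin m → ZMod 2) (hA : BlockSupported L s A₀) :
    RoundInv L s A₀ b₀ m (eliminationPhase L s A₀ b₀) := by
  refine foldl_finRange_induction _ (RoundInv L s A₀ b₀) _ ?_ fun k st => round_inv hs k st
  refine ⟨hA, ⟨1, fun i i' h => Matrix.one_apply_ne h.ne, fun i => Matrix.one_apply_eq i,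
    fun i => ?_, fun i => ?_⟩, by simp, by simp, by simp, by simp, by simp, by simp, by simp,
    by simp⟩
  · rw [← Matrix.mul_apply_eq_vecMul, Matrix.one_mul]
  · change _ = ((1 : Matrix (Fin m) (Fin m) (ZMod 2)) *ᵥ b₀) i
    rw [Matrix.one_mulVec]

end SGauss

namespace SGauss

/-! ### Full row rank -/

/-- The rows of `A` are linearly independent. -/
def RowsIndep {m N : ℕ} (A : Matrix (Fin m) (Fin N) (ZMod 2)) : Prop :=
  ∀ c : Fin m → ZMod 2, c ᵥ* A = 0 → c = 0

theorem rank_eq_iff_rowsIndep {m N : ℕ} (A : Matrix (Fin m) (Fin N) (ZMod 2)) :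
    A.rank = m ↔ RowsIndep A := by
  have h1 : A.rank = m ↔ LinearIndependent (ZMod 2) A.row := by
    rw [linearIndependent_iff_card_eq_finrank_span, Fintype.card_fin,
      Matrix.rank_eq_finrank_span_row]
    exact eq_comm
  rw [h1, ← Matrix.vecMul_injective_iff]
  exact injective_iff_map_eq_zero (Matrix.vecMulLinear A)

theorem isUnit_of_unitLowerTriangular {m : ℕ} {U : Matrix (Fin m) (Fin m) (ZMod 2)}
    (h0 : ∀ i i', i < i' → U i i' = 0) (h1 : ∀ i, U i i = 1) : IsUnit U := by
  rw [Matrix.isUnit_iff_isUnit_det, Matrix.det_of_isLowerTriangular U (fun i i' h => h0 i i' h)]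
  simp [h1]

namespace RoundInv

variable {m N L : ℕ} {s : Fin m → ℕ} {A₀ : Matrix (Fin m) (Fin N) (ZMod 2)} {b₀ : Fin m → ZMod 2}
  {k : ℕ} {st : State m N}

theorem exists_unit (h : RoundInv L s A₀ b₀ k st) : ∃ U : Matrix (Fin m) (Fin m) (ZMod 2),
    IsUnit U ∧ (∀ i i', i < i' → U i i' = 0) ∧ st.A = U * A₀ ∧ st.b = U *ᵥ b₀ := by
  obtain ⟨U, h0, h1, hA, hb⟩ := h.trans
  refine ⟨U, isUnit_of_unitLowerTriangular h0 h1, h0, ?_, funext hb⟩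
  ext i j
  rw [hA i, Matrix.mul_apply_eq_vecMul]

theorem rowsIndep_iff (h : RoundInv L s A₀ b₀ k st) : RowsIndep st.A ↔ RowsIndep A₀ := by
  obtain ⟨U, hU, -, hA, -⟩ := h.exists_unit
  rw [hA]
  have hinj := Matrix.vecMul_injective_iff_isUnit.2 hU
  obtain ⟨V, hVU⟩ := hU.exists_left_inv
  constructor
  · intro hi c hc
    have : (c ᵥ* V) ᵥ* (U * A₀) = 0 := by
      rw [← Matrix.vecMul_vecMul, Matrix.vecMul_vecMul c, hVU, Matrix.vecMul_one, hc]
    have h2 := congrArg (· ᵥ* U) (hi _ this)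
    simpa [Matrix.vecMul_vecMul, hVU] using h2
  · intro hi c hc
    rw [← Matrix.vecMul_vecMul] at hc
    exact hinj ((hi _ hc).trans (Matrix.zero_vecMul U).symm)

/-- Without failure each row has a pivot, and pivot columns vanish below their pivots. Reading a
dependency in these columns kills its coefficients from the top down. After a failure there is a
zero row. -/
theorem failed_eq_false_iff (h : RoundInv L s A₀ b₀ m st) :
    st.failed = false ↔ RowsIndep st.A := by
  constructor
  · intro hf c hc
    have hall : ∀ n (i : Fin m), (i : ℕ) = n → c i = 0 := by
      intro n
      induction n using Nat.strong_induction_on with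
      | _ n ih =>
        intro i hin
        obtain ⟨j, hj⟩ := h.piv_some hf i i.2
        have hcol := congrFun hc j
        rw [Matrix.vecMul, dotProduct, Finset.sum_eq_single i] at hcol
        · simpa [h.piv_one i j hj] using hcol
        · intro i' _ hne
          rcases lt_or_gt_of_ne hne with hlt | hgt
          · rw [ih i' (by rw [← hin]; exact hlt) i' rfl, zero_mul]
          · rw [h.piv_below i j hj i' hgt, mul_zero]
        · simp
    exact funext fun i => hall i i rfl
  · intro hi
    by_contra hf
    obtain ⟨i, hz⟩ := h.zero_row (by simpa using hf)
    have := hi (Pi.single i 1) (by rw [Matrix.single_one_vecMul]; exact hz)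
    have h1 := congrFun this i
    simp at h1

/-- The vector stays zero at the pivots not yet treated, so an update is the addition of a unit
vector. It solves equation `k` and leaves the equations below alone, because column `piv k` vanishes
there. -/
theorem mulVec_backSubst (h : RoundInv L s A₀ b₀ m st) (hf : st.failed = false) :
    A₀ *ᵥ backSubst st = b₀ := by
  have key : (∀ i : Fin m, 0 ≤ (i : ℕ) → backSubst st ⬝ᵥ st.A i = st.b i) ∧
      ∀ i : Fin m, (i : ℕ) < 0 → ∀ j, st.piv i = some j → backSubst st j = 0 := by
    refine foldl_finRange_reverse_induction _
      (fun k z => (∀ i : Fin m, k ≤ (i : ℕ) → z ⬝ᵥ st.A i = st.b i) ∧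
        ∀ i : Fin m, (i : ℕ) < k → ∀ j, st.piv i = some j → z j = 0) 0 ?_ ?_
    · exact ⟨fun i hi => absurd i.2 (not_lt.2 hi), fun _ _ _ _ => rfl⟩
    · rintro k z ⟨hz, hz0⟩
      obtain ⟨j, hj⟩ := h.piv_some hf k k.2
      simp only [hj]
      have hzj := hz0 k (Nat.lt_succ_self _) j hj
      have hupd : Function.update z j (z ⬝ᵥ st.A k + st.b k) =
          z + Pi.single j (z ⬝ᵥ st.A k + st.b k) := by
        ext c
        by_cases hc : c = j
        · subst hc; simp [hzj]
        · simp [hc]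
      rw [hupd]
      refine ⟨fun i hi => ?_, fun i hi j' hj' => ?_⟩
      · rw [add_dotProduct, single_dotProduct]
        by_cases hik : i = k
        · subst hik
          rw [h.piv_one i j hj, mul_one, ← add_assoc, zmod_two_add_self, zero_add]
        · have hlt : k < i := lt_of_le_of_ne hi (Ne.symm hik)
          rw [h.piv_below k j hj i hlt, mul_zero, add_zero]
          exact hz i hlt
      · have hne : j' ≠ j := by
          rintro rfl
          have h1 := h.piv_below i j' hj' k hi
          rw [h.piv_one k j' hj] at h1
          exact one_ne_zero h1
        rw [Pi.add_apply, hz0 i (Nat.lt_succ_of_lt hi) j' hj', Pi.single_eq_of_ne hne, add_zero]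
  have hsol : st.A *ᵥ backSubst st = st.b := by
    funext i
    rw [Matrix.mulVec, dotProduct_comm]
    exact key.1 i (Nat.zero_le _)
  obtain ⟨U, hU, -, hA, hb⟩ := h.exists_unit
  rw [hA, hb, ← Matrix.mulVec_mulVec] at hsol
  exact Matrix.mulVec_injective_iff_isUnit.2 hU hsol

end RoundInv

/-! ### Row additions bounded by kernel vectors -/

/-- The coefficient vectors of rows starting at `j` or earlier whose combination vanishes in the
columns before `j`. -/
def prefixKernel {m N : ℕ} (s : Fin m → ℕ) (A : Matrix (Fin m) (Fin N) (ZMod 2)) (j : ℕ) :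
    Finset (Fin m → ZMod 2) :=
  {c | (∀ i, c i ≠ 0 → s i ≤ j) ∧ ∀ col : Fin N, (col : ℕ) < j → (c ᵥ* A) col = 0}

/-- The rows before row `i'` whose pivot is not to the left of the block of row `i'`. -/
def pendingRows {m N : ℕ} (s : Fin m → ℕ) (st : State m N) (i' : Fin m) : Finset (Fin m) :=
  {i | i < i' ∧ ∃ j, st.piv i = some j ∧ s i' ≤ (j : ℕ)}

theorem RoundInv.length_adds_le {m N L : ℕ} {s : Fin m → ℕ}
    {A₀ : Matrix (Fin m) (Fin N) (ZMod 2)} {b₀ : Fin m → ZMod 2} {st : State m N} {k : ℕ}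
    (h : RoundInv L s A₀ b₀ k st) : st.adds.length ≤ ∑ i', (pendingRows s st i').card := by
  refine h.len.trans_eq ?_
  simp only [pendingRows, Finset.card_filter]
  exact Finset.sum_comm

/-- Every subset of the pending rows sums to a row that vanishes left of the block of `i'`. In terms
of the original rows these sums are sums of rows of `U`: distinct because `U` is invertible, and
supported on rows up to `i'` because it is lower triangular. -/
theorem RoundInv.two_pow_pendingRows_le {m N L : ℕ} {s : Fin m → ℕ} (hs : Monotone s)
    {A₀ : Matrix (Fin m) (Fin N) (ZMod 2)} {b₀ : Fin m → ZMod 2} {st : State m N} {k : ℕ}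
    (h : RoundInv L s A₀ b₀ k st) (i' : Fin m) :
    2 ^ (pendingRows s st i').card ≤ (prefixKernel s A₀ (s i')).card := by
  obtain ⟨U, hU, h0, hA, -⟩ := h.exists_unit
  rw [← Finset.card_powerset]
  refine Finset.card_le_card_of_injOn (fun Q => (fun i => if i ∈ Q then (1 : ZMod 2) else 0) ᵥ* U)
    ?_ ?_
  · intro Q hQ
    have hQ' : ∀ i ∈ Q, i ∈ pendingRows s st i' := fun i hi => Finset.mem_powerset.1 hQ hi
    simp only [pendingRows, Finset.mem_filter, Finset.mem_univ, true_and] at hQ'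
    simp only [prefixKernel, Finset.coe_filter, Finset.mem_univ, true_and, Set.mem_ofPred_eq]
    constructor
    · intro i hi
      by_contra hlt
      apply hi
      rw [Matrix.vecMul, dotProduct]
      refine Finset.sum_eq_zero fun l _ => ?_
      split_ifs with hl
      · have hli : l < i := by
          refine (hQ' l hl).1.trans ?_
          by_contra hle
          exact hlt (hs (not_lt.1 hle))
        rw [h0 l i hli, mul_zero]
      · rw [zero_mul]
    · intro col hcol
      rw [Matrix.vecMul_vecMul, ← hA, Matrix.vecMul, dotProduct]
      refine Finset.sum_eq_zero fun l _ => ?_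
      split_ifs with hl
      · obtain ⟨-, j, hj, hle⟩ := hQ' l hl
        rw [h.piv_left l j hj col (Fin.lt_def.2 (hcol.trans_le hle)), mul_zero]
      · rw [zero_mul]
  · intro Q _ Q' _ hQQ
    have := Matrix.vecMul_injective_iff_isUnit.2 hU hQQ
    ext i
    have hi := congrFun this i
    by_cases h1 : i ∈ Q <;> by_cases h2 : i ∈ Q' <;> simp_all

/-! ### The solver on an unsorted system -/

section Solver

variable {m N L : ℕ} {s : Fin m → ℕ} {A : Matrix (Fin m) (Fin N) (ZMod 2)}

theorem finalState_inv (hA : BlockSupported L s A) (b : Fin m → ZMod 2) :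
    RoundInv L (sortedStarts s) (fun i => A (Tuple.sort s i)) (fun i => b (Tuple.sort s i)) m
      (finalState L s A b) :=
  eliminationPhase_inv (Tuple.monotone_sort s) _ _ fun _ j h => hA _ j h

theorem vecMul_perm (σ : Equiv.Perm (Fin m)) (c : Fin m → ZMod 2) :
    c ᵥ* (fun i => A (σ i) : Matrix (Fin m) (Fin N) (ZMod 2)) = (c ∘ σ.symm) ᵥ* A := by
  funext j
  change ∑ i, c i * A (σ i) j = ∑ i, c (σ.symm i) * A i j
  rw [← Equiv.sum_comp σ fun i => c (σ.symm i) * A i j]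
  simp

theorem rowsIndep_perm (σ : Equiv.Perm (Fin m)) :
    RowsIndep (fun i => A (σ i) : Matrix (Fin m) (Fin N) (ZMod 2)) ↔ RowsIndep A := by
  constructor
  · intro h c hc
    have h1 := h (c ∘ σ) (by rw [vecMul_perm]; simpa [Function.comp_assoc] using hc)
    funext i
    simpa using congrFun h1 (σ.symm i)
  · intro h c hc
    rw [vecMul_perm] at hc
    funext i
    simpa using congrFun (h _ hc) (σ i)

theorem isSome_sgauss_iff (hA : BlockSupported L s A) (b : Fin m → ZMod 2) :
    (sgauss L s A b).isSome = true ↔ RowsIndep A := by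
  have h := finalState_inv hA b
  rw [← rowsIndep_perm (Tuple.sort s), ← h.rowsIndep_iff, ← h.failed_eq_false_iff, sgauss]
  cases (finalState L s A b).failed <;> simp

theorem mulVec_of_sgauss_eq_some (hA : BlockSupported L s A) {b : Fin m → ZMod 2} {z : Fin N → ZMod 2}
    (hz : sgauss L s A b = some z) : A *ᵥ z = b := by
  have h := finalState_inv hA b
  simp only [sgauss] at hz
  split_ifs at hz with hf
  have h1 := h.mulVec_backSubst (by simpa using hf)
  rw [Option.some.inj hz] at h1
  funext i
  have h2 := congrFun h1 ((Tuple.sort s).symm i)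
  simpa [Matrix.mulVec] using h2

theorem good_of_mem_rowAdditions (hA : BlockSupported L s A) {b : Fin m → ZMod 2}
    {e : RowAddition m N} (he : e ∈ rowAdditions L s A b) : e.Good L (sortedStarts s) :=
  (finalState_inv hA b).good e he

/-- A crude bound, used only when the rows are dependent. -/
theorem length_rowAdditions_le_sq (hA : BlockSupported L s A) (b : Fin m → ZMod 2) :
    (rowAdditions L s A b).length ≤ m ^ 2 := by
  refine (finalState_inv hA b).length_adds_le.trans ?_
  refine (Finset.sum_le_card_nsmul _ _ m fun i _ => ?_).trans_eq (by simp [sq])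
  exact (Finset.card_le_univ _).trans_eq (by simp)

theorem card_prefixKernel_perm (σ : Equiv.Perm (Fin m)) (j : ℕ) :
    (prefixKernel (s ∘ σ) (fun i => A (σ i) : Matrix (Fin m) (Fin N) (ZMod 2)) j).card ≤
      (prefixKernel s A j).card := by
  refine Finset.card_le_card_of_injOn (fun c => c ∘ σ.symm) ?_ ?_
  · intro c hc
    simp only [prefixKernel, Finset.coe_filter, Finset.mem_univ, true_and, Set.mem_ofPred_eq,
      vecMul_perm] at hc ⊢
    exact ⟨fun i hi => by simpa using hc.1 (σ.symm i) hi, hc.2⟩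
  · intro c _ c' _ h
    funext i
    simpa using congrFun h (σ i)

theorem exists_length_rowAdditions_le (hA : BlockSupported L s A) (b : Fin m → ZMod 2) :
    ∃ r : Fin m → ℕ, (rowAdditions L s A b).length ≤ ∑ i, r i ∧
      ∀ i, 2 ^ r i ≤ (prefixKernel s A (s i)).card := by
  have h := finalState_inv hA b
  refine ⟨fun i => (pendingRows (sortedStarts s) (finalState L s A b) ((Tuple.sort s).symm i)).card,
    ?_, fun i => ?_⟩
  · rw [Equiv.sum_comp (Tuple.sort s).symm
      fun i => (pendingRows (sortedStarts s) (finalState L s A b) i).card]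
    exact h.length_adds_le
  · refine (h.two_pow_pendingRows_le (Tuple.monotone_sort s) _).trans ?_
    refine (card_prefixKernel_perm (Tuple.sort s) _).trans_eq ?_
    simp

end Solver

end SGauss

namespace SGauss

/-! ### Linear dependencies among rows with short random blocks -/

/-- The entry in column `c` of the row `i` that holds its block `β i` in the columns
`s i, …, s i + L - 1`. -/
def bandEntry {m L : ℕ} (s : Fin m → ℕ) (β : Fin m → Fin L → ZMod 2) (i : Fin m) (c : ℕ) : ZMod 2 :=
  if h : s i ≤ c ∧ c - s i < L then β i ⟨c - s i, h.2⟩ else 0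

theorem bandMatrix_apply {m n L : ℕ} (ω : Sample m n L) (i : Fin m) (j : Fin (n + L - 1)) :
    bandMatrix ω i j = bandEntry (starts ω) (fun i => (ω i).2) i j := rfl

section Band

variable {m L : ℕ} {s : Fin m → ℕ}

theorem bandEntry_of_lt {β : Fin m → Fin L → ZMod 2} {i : Fin m} {c : ℕ} (h : c < s i) :
    bandEntry s β i c = 0 :=
  dif_neg fun hh => absurd hh.1 (not_le.2 h)

theorem bandEntry_of_le {β : Fin m → Fin L → ZMod 2} {i : Fin m} {c : ℕ} (h : s i + L ≤ c) :
    bandEntry s β i c = 0 :=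
  dif_neg fun hh => by omega

theorem bandEntry_add (β γ : Fin m → Fin L → ZMod 2) (i : Fin m) (c : ℕ) :
    bandEntry s (β + γ) i c = bandEntry s β i c + bandEntry s γ i c := by
  unfold bandEntry
  split_ifs <;> simp

theorem blockSupported_bandMatrix {n : ℕ} (ω : Sample m n L) :
    BlockSupported L (starts ω) (bandMatrix ω) := by
  intro i j h
  rw [bandMatrix_apply] at h
  constructor
  · by_contra hlt
    exact h (bandEntry_of_lt (not_le.1 hlt))
  · by_contra hlt
    exact h (bandEntry_of_le (not_lt.1 hlt))

/-- The column `c` lies in the block of some row used by the combination `v`. -/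
def Covers (L : ℕ) (s : Fin m → ℕ) (v : Fin m → ZMod 2) (c : ℕ) : Prop :=
  ∃ i, v i ≠ 0 ∧ s i ≤ c ∧ c < s i + L

/-- The combinations of rows starting in `[p, r)` whose blocks cover the columns `[p, q)` and
whose sum vanishes there. -/
def IsSpanDependency (s : Fin m → ℕ) (β : Fin m → Fin L → ZMod 2) (p r q : ℕ)
    (v : Fin m → ZMod 2) : Prop :=
  (∀ i, v i ≠ 0 → p ≤ s i ∧ s i < r) ∧ (∀ c, p ≤ c → c < q → Covers L s v c) ∧
    ∀ c, p ≤ c → c < q → ∑ i, v i * bandEntry s β i c = 0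

open Classical in
/-- The set of all span dependencies. -/
noncomputable def spanDependencies (s : Fin m → ℕ) (β : Fin m → Fin L → ZMod 2) (p r q : ℕ) :
    Finset (Fin m → ZMod 2) :=
  {v | IsSpanDependency s β p r q v}

theorem mem_spanDependencies {β : Fin m → Fin L → ZMod 2} {p r q : ℕ} {v : Fin m → ZMod 2} :
    v ∈ spanDependencies s β p r q ↔ IsSpanDependency s β p r q v := by
  simp [spanDependencies]

/-- The number of rows starting in `[p, r)`. -/
def startsIn (s : Fin m → ℕ) (p r : ℕ) : ℕ :=
  (Finset.univ.filter fun i => p ≤ s i ∧ s i < r).card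

-- In each covered column one covering row is selected, and flipping its bit there flips the column
-- sum. Translating the solutions by the resulting 2^(q-p) patterns gives disjoint copies, since the
-- pattern can be read off from the column sums.
open Classical in
theorem card_vanishing_mul_le {v : Fin m → ZMod 2} {p q : ℕ}
    (hcov : ∀ c, p ≤ c → c < q → Covers L s v c) :
    (Finset.univ.filter fun β : Fin m → Fin L → ZMod 2 =>
      ∀ c, p ≤ c → c < q → ∑ i, v i * bandEntry s β i c = 0).card * 2 ^ (q - p) ≤
      Fintype.card (Fin m → Fin L → ZMod 2) := by
  -- The selected row is encoded as a predicate, because columns outside [p, q) need not have one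
  -- and `Fin m` may be empty.
  have hex : ∀ c : ℕ, ∃ i : Fin m → Prop, (p ≤ c → c < q → ∃ i₀, v i₀ ≠ 0 ∧ s i₀ ≤ c ∧
      c < s i₀ + L ∧ ∀ k, i k ↔ k = i₀) := by
    intro c
    by_cases h : p ≤ c ∧ c < q
    · obtain ⟨i₀, h1, h2, h3⟩ := hcov c h.1 h.2
      exact ⟨fun k => k = i₀, fun _ _ => ⟨i₀, h1, h2, h3, fun _ => Iff.rfl⟩⟩
    · exact ⟨fun _ => False, fun h1 h2 => absurd ⟨h1, h2⟩ h⟩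
  choose rep hrep using hex
  let σ : (Fin (q - p) → ZMod 2) → Fin m → Fin L → ZMod 2 := fun y i l =>
    if h : p ≤ s i + l ∧ s i + l < q then
      if rep (s i + l) i then y ⟨s i + l - p, by omega⟩ else 0
    else 0
  have hσ : ∀ y c (h1 : p ≤ c) (h2 : c < q),
      ∑ i, v i * bandEntry s (σ y) i c = y ⟨c - p, by omega⟩ := by
    intro y c h1 h2
    obtain ⟨i₀, hv, hs1, hs2, huniq⟩ := hrep c h1 h2
    have hval : ∀ i, bandEntry s (σ y) i c =
        if s i ≤ c ∧ c - s i < L then if i = i₀ then y ⟨c - p, by omega⟩ else 0 else 0 := by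
      intro i
      unfold bandEntry
      split_ifs with hb hi
      · have hc : s i + (c - s i) = c := by omega
        have h3 : rep c i := (huniq i).2 hi
        simp only [σ, hc, h1, h2, h3, and_self, dif_pos, if_true]
      · have hc : s i + (c - s i) = c := by omega
        have h3 : ¬ rep c i := fun h => hi ((huniq i).1 h)
        simp only [σ, hc, h1, h2, h3, and_self, dif_pos, if_false]
      · rfl
    rw [Finset.sum_eq_single i₀]
    · rw [hval, if_pos ⟨hs1, by omega⟩, if_pos rfl, zmod_two_eq_one hv, one_mul]
    · intro i _ hi
      rw [hval]
      simp [hi]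
    · simp
  have hy : Fintype.card (Fin (q - p) → ZMod 2) = 2 ^ (q - p) := by simp
  rw [← hy, ← Finset.card_univ, ← Finset.card_product, ← Finset.card_univ]
  refine Finset.card_le_card_of_injOn (fun x => x.1 + σ x.2) (fun _ _ => Finset.mem_univ _) ?_
  rintro ⟨β, y⟩ hβ ⟨β', y'⟩ hβ' heq
  simp only [Finset.coe_product, Set.mem_prod, Finset.mem_coe, Finset.mem_filter,
    Finset.mem_univ, true_and, and_true] at hβ hβ'
  have hev : ∀ β y, (∀ c, p ≤ c → c < q → ∑ i, v i * bandEntry s β i c = 0) →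
      ∀ c (h1 : p ≤ c) (h2 : c < q),
        ∑ i, v i * bandEntry s (β + σ y) i c = y ⟨c - p, by omega⟩ := by
    intro β y hβ c h1 h2
    simp only [bandEntry_add, mul_add, Finset.sum_add_distrib]
    rw [hβ c h1 h2, hσ y c h1 h2, zero_add]
  have hyy : y = y' := by
    funext t
    have h1 := hev β y hβ (p + t) (by omega) (by omega)
    have h2 := hev β' y' hβ' (p + t) (by omega) (by omega)
    simp only at heq
    rw [heq, h2] at h1
    simpa using h1.symm
  subst hyy
  simpa using heq

/-- First moment bound for the number of span dependencies. -/
theorem sum_card_spanDependencies_mul_le (s : Fin m → ℕ) (p r q : ℕ) :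
    (∑ β : Fin m → Fin L → ZMod 2, (spanDependencies s β p r q).card) * 2 ^ (q - p) ≤
      2 ^ startsIn s p r * Fintype.card (Fin m → Fin L → ZMod 2) := by
  classical
  set F : Finset (Fin m → ZMod 2) := {v | (∀ i, v i ≠ 0 → p ≤ s i ∧ s i < r) ∧
    ∀ c, p ≤ c → c < q → Covers L s v c} with hF
  have hFcard : F.card ≤ 2 ^ startsIn s p r := by
    rw [startsIn, ← Finset.card_powerset]
    refine Finset.card_le_card_of_injOn (fun v => Finset.univ.filter fun i => v i ≠ 0) ?_ ?_
    · intro v hv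
      simp only [hF, Finset.coe_filter, Finset.mem_univ, true_and, Set.mem_ofPred_eq] at hv
      simp only [Finset.coe_powerset, Set.mem_preimage, Set.mem_powerset_iff, Finset.coe_subset]
      intro i hi
      simp only [Finset.mem_filter, Finset.mem_univ, true_and] at hi ⊢
      exact hv.1 i hi
    · intro v _ v' _ h
      funext i
      have hi := Finset.ext_iff.1 h i
      simp only [Finset.mem_filter, Finset.mem_univ, true_and] at hi
      by_cases h0 : v i = 0
      · by_cases h0' : v' i = 0
        · rw [h0, h0']
        · exact absurd h0 (hi.2 h0')
      · rw [zmod_two_eq_one h0, zmod_two_eq_one (hi.1 h0)]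
  have hswap : ∑ β : Fin m → Fin L → ZMod 2, (spanDependencies s β p r q).card =
      ∑ v ∈ F, (Finset.univ.filter fun β : Fin m → Fin L → ZMod 2 =>
        ∀ c, p ≤ c → c < q → ∑ i, v i * bandEntry s β i c = 0).card := by
    have h1 : ∀ β : Fin m → Fin L → ZMod 2, spanDependencies s β p r q =
        F.filter fun v => ∀ c, p ≤ c → c < q → ∑ i, v i * bandEntry s β i c = 0 := by
      intro β
      ext v
      simp only [mem_spanDependencies, IsSpanDependency, hF, Finset.mem_filter, Finset.mem_univ,
        true_and, and_assoc]
    simp only [h1, Finset.card_filter]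
    exact Finset.sum_comm
  rw [hswap, Finset.sum_mul]
  refine (Finset.sum_le_card_nsmul _ _ (Fintype.card (Fin m → Fin L → ZMod 2)) fun v hv => ?_).trans
    ?_
  · exact card_vanishing_mul_le (Finset.mem_filter.1 hv).2.2
  · rw [smul_eq_mul]
    exact Nat.mul_le_mul_right _ hFcard

theorem vecMul_bandMatrix {n : ℕ} (ω : Sample m n L) (v : Fin m → ZMod 2) (j : Fin (n + L - 1)) :
    (v ᵥ* bandMatrix ω) j = ∑ i, v i * bandEntry (starts ω) (fun i => (ω i).2) i j := rfl

theorem starts_lt {n : ℕ} (ω : Sample m n L) (i : Fin m) : starts ω i < n := (ω i).1.2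

/-- A linear dependency among the rows contains one that covers an interval. -/
theorem exists_spanDependency_of_not_rowsIndep {n : ℕ} (hL : 1 ≤ L) (ω : Sample m n L)
    (h : ¬ RowsIndep (bandMatrix ω)) : ∃ p < n, ∃ y, 1 ≤ y ∧ y ≤ n ∧
      (spanDependencies (starts ω) (fun i => (ω i).2) p (p + y) (p + (y + L - 1))).Nonempty := by
  classical
  unfold RowsIndep at h
  push Not at h
  obtain ⟨v, hv, hv0⟩ := h
  have hne : (Finset.univ.filter fun i => v i ≠ 0).Nonempty := by
    by_contra hemp
    rw [Finset.not_nonempty_iff_eq_empty, Finset.filter_eq_empty_iff] at hemp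
    exact hv0 (funext fun i => by simpa using hemp (Finset.mem_univ i))
  obtain ⟨i₀, hi₀, hmin⟩ := Finset.exists_min_image _ (starts ω) hne
  simp only [Finset.mem_filter, Finset.mem_univ, true_and] at hi₀ hmin
  set s := starts ω with hs
  have hlt : ∀ i, s i < n := starts_lt ω
  -- Let `q` be the first uncovered column from the leftmost start on. No used block straddles it,
  -- so the rows starting before `q` cancel among themselves.
  have hex : ∃ q, s i₀ ≤ q ∧ ¬ Covers L s v q := by
    refine ⟨n + L - 1, by have := hlt i₀; omega, ?_⟩
    rintro ⟨i, -, -, hi⟩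
    have := hlt i
    omega
  obtain ⟨hq1, hq2⟩ := Nat.find_spec hex
  have hqle : Nat.find hex ≤ n + L - 1 := by
    refine Nat.find_min' hex ⟨by have := hlt i₀; omega, ?_⟩
    rintro ⟨i, -, -, hi⟩
    have := hlt i
    omega
  have hqmin : ∀ c, s i₀ ≤ c → c < Nat.find hex → Covers L s v c := fun c h1 h2 => by
    by_contra hc
    exact Nat.find_min hex h2 ⟨h1, hc⟩
  generalize Nat.find hex = q at hq1 hq2 hqle hqmin
  have hend : ∀ i, v i ≠ 0 → s i < q → s i + L ≤ q := fun i hi hiq => by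
    by_contra hh
    exact hq2 ⟨i, hi, hiq.le, not_le.1 hh⟩
  have hstart : s i₀ + L ≤ q := by
    by_contra hh
    exact hq2 ⟨i₀, hi₀, hq1, not_le.1 hh⟩
  -- All blocks kept end by `q`, so the last possible start is `q - L`. This leaves `q + 1 - s i₀ -
  -- L` starting positions, against L - 1 more covered columns.
  refine ⟨s i₀, hlt i₀, q + 1 - s i₀ - L, by omega, by omega,
    fun i => if s i < q then v i else 0, ?_⟩
  have hqq : s i₀ + (q + 1 - s i₀ - L + L - 1) = q := by omega
  rw [mem_spanDependencies, hqq]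
  refine ⟨fun i hi => ?_, fun c h1 h2 => ?_, fun c h1 h2 => ?_⟩
  · simp only [ne_eq, ite_eq_right_iff, Classical.not_imp] at hi
    have := hend i hi.2 hi.1
    exact ⟨hmin i hi.2, by omega⟩
  · obtain ⟨i, hi, hi1, hi2⟩ := hqmin c h1 h2
    exact ⟨i, by simpa [hi1.trans_lt h2] using hi, hi1, hi2⟩
  · have hcol := congrFun hv ⟨c, by omega⟩
    rw [vecMul_bandMatrix] at hcol
    refine Eq.trans (Finset.sum_congr rfl fun i _ => ?_) hcol
    dsimp only
    split_ifs with hi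
    · rfl
    · rw [bandEntry_of_lt (by omega : c < s i), mul_zero, mul_zero]

/-- If the rows are independent, the dependencies in the columns before `j` are those of rows
starting at `j` and span dependencies. -/
theorem card_prefixKernel_le {n : ℕ} (ω : Sample m n L) (h : RowsIndep (bandMatrix ω)) {j : ℕ}
    (hj : j < n) : (prefixKernel (starts ω) (bandMatrix ω) j).card ≤
      2 ^ startsIn (starts ω) j (j + 1) * ∑ p ∈ Finset.range (j + 1),
        (spanDependencies (starts ω) (fun i => (ω i).2) p j j).card := by
  classical
  set s := starts ω with hs
  rw [startsIn, ← Finset.card_powerset]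
  refine le_trans ?_ (Nat.mul_le_mul_left _ Finset.card_biUnion_le)
  rw [← Finset.card_product]
  -- Rows starting at `j` have no entry left of `j` and may be chosen freely; the remaining part of
  -- `v` must be a span dependency.
  refine Finset.card_le_card_of_injOn (fun v => (Finset.univ.filter fun i => s i = j ∧ v i ≠ 0,
    fun i => if s i < j then v i else 0)) ?_ ?_
  · intro v hv
    simp only [prefixKernel, Finset.coe_filter, Finset.mem_univ, true_and, Set.mem_ofPred_eq] at hv
    obtain ⟨hsupp, hzero⟩ := hv
    simp only [Finset.coe_product, Set.mem_prod, Finset.mem_coe, Finset.mem_powerset,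
      Finset.mem_biUnion, Finset.mem_range, mem_spanDependencies]
    refine ⟨fun i hi => ?_, ?_⟩
    · simp only [Finset.mem_filter, Finset.mem_univ, true_and] at hi ⊢
      omega
    · set u : Fin m → ZMod 2 := fun i => if s i < j then v i else 0 with hu
      have hus : ∀ i, u i ≠ 0 → s i < j := fun i hi => by
        by_contra hh
        exact hi (if_neg hh)
      have hLn : ∀ c, c < j → ∑ i, u i * bandEntry s (fun i => (ω i).2) i c = 0 := by
        intro c hc
        by_cases hL : L = 0
        · exact Finset.sum_eq_zero fun i _ => by
            rw [bandEntry, dif_neg (by omega), mul_zero]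
        have hcol := hzero ⟨c, by omega⟩ hc
        rw [vecMul_bandMatrix] at hcol
        refine Eq.trans (Finset.sum_congr rfl fun i _ => ?_) hcol
        simp only [hu]
        split_ifs with hi
        · rfl
        · rw [bandEntry_of_lt (by omega : c < s i), mul_zero, mul_zero]
      -- Take `p` minimal such that [p, j) is covered; `p = j` is allowed. Column `p - 1` is then
      -- uncovered, so used blocks starting before `p` end before it. These rows would be a
      -- dependency of the whole matrix, which independence excludes.
      have hex : ∃ p, p ≤ j ∧ ∀ c, p ≤ c → c < j → Covers L s u c :=
        ⟨j, le_rfl, fun c h1 h2 => absurd h1 (not_le.2 h2)⟩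
      obtain ⟨hp1, hp2⟩ := Nat.find_spec hex
      have hpmin : ∀ p' < Nat.find hex, ¬ (p' ≤ j ∧ ∀ c, p' ≤ c → c < j → Covers L s u c) :=
        fun p' hp' => Nat.find_min hex hp'
      generalize Nat.find hex = p at hp1 hp2 hpmin
      have hbefore : ∀ i, u i ≠ 0 → s i < p → s i + L < p := by
        intro i hi hip
        by_contra hh
        refine hpmin (p - 1) (by omega) ⟨by omega, fun c h1 h2 => ?_⟩
        by_cases hc : p ≤ c
        · exact hp2 c hc h2
        · exact ⟨i, hi, by omega, by omega⟩
      have hzero' : (fun i => if s i < p then u i else 0) = 0 := by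
        apply h
        funext c
        rw [vecMul_bandMatrix]
        by_cases hc : (c : ℕ) < p
        · refine Eq.trans (Finset.sum_congr rfl fun i _ => ?_) (hLn c (by omega))
          split_ifs with hi
          · rfl
          · rw [bandEntry_of_lt (by omega : (c : ℕ) < s i), mul_zero, mul_zero]
        · refine Finset.sum_eq_zero fun i _ => ?_
          split_ifs with hi
          · by_cases hui : u i = 0
            · rw [hui, zero_mul]
            · rw [bandEntry_of_le (show s i + L ≤ c by have := hbefore i hui hi; omega), mul_zero]
          · rw [zero_mul]
      refine ⟨p, by omega, fun i hi => ⟨?_, hus i hi⟩, hp2, fun c _ h2 => hLn c h2⟩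
      by_contra hh
      have := congrFun hzero' i
      simp only [not_le.1 hh, if_true, Pi.zero_apply] at this
      exact hi this
  · intro v hv v' hv' heq
    simp only [prefixKernel, Finset.coe_filter, Finset.mem_univ, true_and, Set.mem_ofPred_eq] at hv hv'
    obtain ⟨h1, h2⟩ := Prod.ext_iff.1 heq
    funext i
    rcases lt_trichotomy (s i) j with hi | hi | hi
    · simpa [hi] using congrFun h2 i
    · have h3 := Finset.ext_iff.1 h1 i
      simp only [Finset.mem_filter, Finset.mem_univ, true_and, hi] at h3
      by_cases h0 : v i = 0
      · by_cases h0' : v' i = 0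
        · rw [h0, h0']
        · exact absurd h0 (h3.2 h0')
      · rw [zmod_two_eq_one h0, zmod_two_eq_one (h3.1 h0)]
    · have h0 : v i = 0 := by
        by_contra hh
        exact absurd (hv.1 i hh) (not_le.2 hi)
      have h0' : v' i = 0 := by
        by_contra hh
        exact absurd (hv'.1 i hh) (not_le.2 hi)
      rw [h0, h0']

end Band

end SGauss

namespace SGauss

/-! ### Uniform expectations -/

section Expectation

variable {Ω : Type} [Fintype Ω]

theorem unifExpect_mono {f g : Ω → ℝ} (h : ∀ ω, f ω ≤ g ω) : unifExpect f ≤ unifExpect g :=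
  div_le_div_of_nonneg_right (Finset.sum_le_sum fun ω _ => h ω) (Nat.cast_nonneg _)

theorem unifExpect_nonneg {f : Ω → ℝ} (h : ∀ ω, 0 ≤ f ω) : 0 ≤ unifExpect f :=
  div_nonneg (Finset.sum_nonneg fun ω _ => h ω) (Nat.cast_nonneg _)

theorem unifExpect_add (f g : Ω → ℝ) :
    unifExpect (fun ω => f ω + g ω) = unifExpect f + unifExpect g := by
  simp only [unifExpect, Finset.sum_add_distrib, add_div]

theorem unifExpect_mul_left (c : ℝ) (f : Ω → ℝ) :
    unifExpect (fun ω => c * f ω) = c * unifExpect f := by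
  simp only [unifExpect, ← Finset.mul_sum, mul_div_assoc]

theorem unifExpect_sum {ι : Type*} (I : Finset ι) (f : ι → Ω → ℝ) :
    unifExpect (fun ω => ∑ i ∈ I, f i ω) = ∑ i ∈ I, unifExpect (f i) := by
  simp only [unifExpect]
  rw [Finset.sum_comm, Finset.sum_div]

theorem unifExpect_const [Nonempty Ω] (c : ℝ) : unifExpect (fun _ : Ω => c) = c := by
  have : (Fintype.card Ω : ℝ) ≠ 0 := Nat.cast_ne_zero.2 Fintype.card_ne_zero
  simp [unifExpect, this]

theorem unifProb_eq_unifExpect (E : Ω → Prop) [DecidablePred E] :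
    unifProb E = unifExpect fun ω => if E ω then (1 : ℝ) else 0 := by
  simp only [unifProb, unifExpect, Finset.sum_boole]
  congr!

theorem unifProb_eq_one_sub [Nonempty Ω] (E : Ω → Prop) :
    unifProb E = 1 - unifProb fun ω => ¬ E ω := by
  classical
  rw [unifProb_eq_unifExpect, unifProb_eq_unifExpect, eq_sub_iff_add_eq, ← unifExpect_add]
  refine Eq.trans (congrArg _ (funext fun ω => ?_)) (unifExpect_const (Ω := Ω) 1)
  by_cases h : E ω <;> simp [h]

theorem unifExpect_sample {m n L : ℕ} (f : Sample m n L → ℝ) :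
    unifExpect f = unifExpect fun s : Fin m → Fin n =>
      unifExpect fun β : Fin m → Fin L → ZMod 2 => f fun i => (s i, β i) := by
  have hcard : Fintype.card (Sample m n L) =
      Fintype.card (Fin m → Fin n) * Fintype.card (Fin m → Fin L → ZMod 2) := by
    rw [← Fintype.card_prod]
    exact Fintype.card_congr (Equiv.arrowProdEquivProdArrow _ _ _)
  have hsum : ∑ ω, f ω = ∑ s : Fin m → Fin n, ∑ β : Fin m → Fin L → ZMod 2,
      f fun i => (s i, β i) := by
    rw [← Fintype.sum_prod_type']
    exact (Equiv.sum_comp (Equiv.arrowProdEquivProdArrow (Fin m) (fun _ => Fin n)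
      (fun _ => Fin L → ZMod 2)).symm f).symm
  simp only [unifExpect]
  rw [hsum, hcard, ← Finset.sum_div, Nat.cast_mul, div_div, mul_comm (Fintype.card _ : ℝ)]

end Expectation

/-! ### The starting positions -/

section Starts

variable {m n : ℕ}

/-- The starting positions as natural numbers. -/
def toStarts (s : Fin m → Fin n) : Fin m → ℕ := fun i => s i

theorem exp_mul_startsIn (t : ℝ) (s : Fin m → Fin n) (p r : ℕ) :
    Real.exp (t * startsIn (toStarts s) p r) =
      ∏ i, if p ≤ (s i : ℕ) ∧ (s i : ℕ) < r then Real.exp t else 1 := by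
  rw [Finset.prod_ite, Finset.prod_const_one, mul_one, Finset.prod_const, startsIn, mul_comm,
    Real.exp_nat_mul]
  rfl

theorem unifExpect_exp_startsIn_le {t : ℝ} (ht : 0 ≤ t) (hn : 0 < n) (p y : ℕ) :
    unifExpect (fun s : Fin m → Fin n => Real.exp (t * startsIn (toStarts s) p (p + y))) ≤
      Real.exp (m / n * y * (Real.exp t - 1)) := by
  have hn' : (0 : ℝ) < n := Nat.cast_pos.2 hn
  have het : 0 ≤ Real.exp t - 1 := sub_nonneg.2 (Real.one_le_exp ht)
  simp only [exp_mul_startsIn]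
  have hpow : ∑ s : Fin m → Fin n, ∏ i, (if p ≤ (s i : ℕ) ∧ (s i : ℕ) < p + y then Real.exp t
      else (1 : ℝ)) = (∑ k : Fin n, if p ≤ (k : ℕ) ∧ (k : ℕ) < p + y then Real.exp t else 1) ^ m :=
    (Fintype.sum_pow (fun k : Fin n => if p ≤ (k : ℕ) ∧ (k : ℕ) < p + y then Real.exp t
      else (1 : ℝ)) m).symm
  have hcard : (Finset.univ.filter fun k : Fin n => p ≤ (k : ℕ) ∧ (k : ℕ) < p + y).card ≤ y := by
    refine (Finset.card_le_card_of_injOn (t := Finset.Ico p (p + y)) (fun k : Fin n => (k : ℕ))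
      (fun k hk => ?_) (fun _ _ _ _ h => Fin.ext h)).trans_eq (by simp)
    simpa using hk
  have hsum : (∑ k : Fin n, if p ≤ (k : ℕ) ∧ (k : ℕ) < p + y then Real.exp t else 1) ≤
      n + y * (Real.exp t - 1) := by
    have h1 : ∀ k : Fin n, (if p ≤ (k : ℕ) ∧ (k : ℕ) < p + y then Real.exp t else 1) =
        1 + (if p ≤ (k : ℕ) ∧ (k : ℕ) < p + y then (1 : ℝ) else 0) * (Real.exp t - 1) := by
      intro k; split_ifs <;> ring
    simp only [h1, Finset.sum_add_distrib, ← Finset.sum_mul, Finset.sum_boole]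
    simp only [Finset.sum_const, Finset.card_univ, Fintype.card_fin, nsmul_eq_mul, mul_one]
    gcongr
  have hnn : (0 : ℝ) ≤ ∑ k : Fin n, if p ≤ (k : ℕ) ∧ (k : ℕ) < p + y then Real.exp t else 1 :=
    Finset.sum_nonneg fun k _ => by split_ifs <;> positivity
  rw [unifExpect, hpow]
  simp only [Fintype.card_fun, Fintype.card_fin, Nat.cast_pow]
  rw [← div_pow]
  calc _ ≤ ((n + y * (Real.exp t - 1)) / n) ^ m := by gcongr
    _ = (y * (Real.exp t - 1) / n + 1) ^ m := by congr 1; field_simp; ring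
    _ ≤ Real.exp (y * (Real.exp t - 1) / n) ^ m := by
        gcongr
        exact Real.add_one_le_exp _
    _ = _ := by rw [← Real.exp_nat_mul]; congr 1; ring

/-- The number of rows starting at `j`. -/
def arrivals (s : Fin m → ℕ) (j : ℕ) : ℕ := startsIn s j (j + 1)

/-- The backlog of a queue with `arrivals s j` arrivals and service rate `1 - δ`. -/
noncomputable def backlog (δ : ℝ) (s : Fin m → ℕ) : ℕ → ℝ
  | 0 => 0
  | j + 1 => max 0 (backlog δ s j + arrivals s j - (1 - δ))

theorem backlog_nonneg (δ : ℝ) (s : Fin m → ℕ) (j : ℕ) : 0 ≤ backlog δ s j := by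
  cases j with
  | zero => exact le_rfl
  | succ j => exact le_max_left _ _

theorem startsIn_succ (s : Fin m → ℕ) {p j : ℕ} (h : p ≤ j) :
    startsIn s p (j + 1) = startsIn s p j + arrivals s j := by
  rw [arrivals, startsIn, startsIn, startsIn, ← Finset.card_union_of_disjoint]
  · congr 1
    ext i
    simp only [Finset.mem_filter, Finset.mem_univ, true_and, Finset.mem_union]
    omega
  · rw [Finset.disjoint_filter]
    intro i _ h1 h2
    omega

/-- One number controls the excess over the service rate on all intervals ending at `j` at once,
which is what the sum over `p` requires. -/
theorem startsIn_le_backlog (δ : ℝ) (s : Fin m → ℕ) {p j : ℕ} (h : p ≤ j) :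
    (startsIn s p j : ℝ) ≤ (1 - δ) * (j - p) + backlog δ s j := by
  induction j, h using Nat.le_induction with
  | base =>
    have : startsIn s p p = 0 := by
      rw [startsIn, Finset.card_eq_zero, Finset.filter_eq_empty_iff]
      intro i _; omega
    simp [this, backlog_nonneg]
  | succ j hj ih =>
    rw [startsIn_succ s hj]
    have : backlog δ s j + arrivals s j - (1 - δ) ≤ backlog δ s (j + 1) := le_max_right _ _
    push_cast
    linarith

theorem backlog_mono (δ : ℝ) {s s' : Fin m → ℕ} {j : ℕ}
    (h : ∀ k < j, arrivals s k ≤ arrivals s' k) : backlog δ s j ≤ backlog δ s' j := by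
  induction j with
  | zero => exact le_rfl
  | succ j ih =>
    have h1 := ih fun k hk => h k (hk.trans (Nat.lt_succ_self j))
    have h2 : (arrivals s j : ℝ) ≤ arrivals s' j := Nat.cast_le.2 (h j (Nat.lt_succ_self j))
    simp only [backlog]
    gcongr

theorem backlog_sq_succ_le (δ : ℝ) (s : Fin m → ℕ) (j : ℕ) :
    backlog δ s (j + 1) ^ 2 ≤ backlog δ s j ^ 2 + 2 * backlog δ s j * (arrivals s j - (1 - δ)) +
      (arrivals s j - (1 - δ)) ^ 2 := by
  have h : backlog δ s (j + 1) ^ 2 ≤ (backlog δ s j + arrivals s j - (1 - δ)) ^ 2 := by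
    rw [backlog]
    rcases le_total 0 (backlog δ s j + arrivals s j - (1 - δ)) with h | h
    · rw [max_eq_right h]
    · rw [max_eq_left h, zero_pow two_ne_zero]; exact sq_nonneg _
  refine h.trans_eq (by ring)

/-- The one-step bounds on the squared backlog telescope, and the final square is dropped. The
inequality holds for every choice of starts; expectations enter only later. -/
theorem sum_backlog_le {δ : ℝ} (h0 : 0 ≤ δ) (h1 : δ ≤ 1) (s : Fin m → ℕ) (N : ℕ) :
    2 * (1 - δ) * ∑ j ∈ Finset.range N, backlog δ s j ≤
      2 * ∑ j ∈ Finset.range N, arrivals s j * backlog δ s j +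
        ∑ j ∈ Finset.range N, (arrivals s j : ℝ) * arrivals s j + N := by
  have key : backlog δ s N ^ 2 + 2 * (1 - δ) * ∑ j ∈ Finset.range N, backlog δ s j ≤
      2 * ∑ j ∈ Finset.range N, arrivals s j * backlog δ s j +
        ∑ j ∈ Finset.range N, (arrivals s j : ℝ) * arrivals s j + N := by
    induction N with
    | zero => simp [backlog]
    | succ N ih =>
      simp only [Finset.sum_range_succ]
      have h2 := backlog_sq_succ_le δ s N
      have h3 : ((arrivals s N : ℝ) - (1 - δ)) ^ 2 ≤ arrivals s N * arrivals s N + 1 := by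
        have : (0 : ℝ) ≤ arrivals s N := Nat.cast_nonneg _
        nlinarith [mul_nonneg this (sub_nonneg.2 h1)]
      push_cast
      nlinarith
  have := sq_nonneg (backlog δ s N)
  linarith

theorem card_filter_eq_arrivals (s : Fin m → Fin n) (j : Fin n) :
    (Finset.univ.filter fun i => s i = j).card = arrivals (toStarts s) j := by
  rw [arrivals, startsIn]
  congr 1
  ext i
  simp only [Finset.mem_filter, Finset.mem_univ, true_and, Fin.ext_iff]
  simp only [toStarts]
  constructor <;> intro h <;> omega

theorem sum_starts_eq (s : Fin m → Fin n) (f : ℕ → ℝ) :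
    ∑ i, f (s i) = ∑ j ∈ Finset.range n, arrivals (toStarts s) j * f j := by
  rw [Finset.sum_range, ← Finset.sum_fiberwise Finset.univ s]
  refine Finset.sum_congr rfl fun j _ => ?_
  rw [← card_filter_eq_arrivals, ← nsmul_eq_mul, ← Finset.sum_const]
  exact Finset.sum_congr rfl fun i hi => by rw [(Finset.mem_filter.1 hi).2]

/-- Placing row `i` at `j` is as likely as placing it anywhere else. -/
theorem mul_sum_ite_le (i : Fin m) (j : Fin n) {f g : (Fin m → Fin n) → ℝ}
    (h : ∀ s, f (Function.update s i j) ≤ g s) :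
    n * ∑ s, (if s i = j then f s else 0) ≤ ∑ s, g s := by
  have hk : ∀ k : Fin n, ∑ s, (if s i = j then f s else 0) ≤
      ∑ s ∈ Finset.univ.filter (fun s : Fin m → Fin n => s i = k), g s := by
    intro k
    rw [← Finset.sum_filter]
    have hbij : ∑ s ∈ Finset.univ.filter (fun s : Fin m → Fin n => s i = j), f s =
        ∑ s ∈ Finset.univ.filter (fun s : Fin m → Fin n => s i = k),
          f (Function.update s i j) := by
      refine Finset.sum_nbij' (fun s => Function.update s i k) (fun s => Function.update s i j)
        ?_ ?_ ?_ ?_ ?_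
      · intro s _; simp
      · intro s _; simp
      · intro s hs
        rw [← (Finset.mem_filter.1 hs).2]; simp
      · intro s hs
        rw [← (Finset.mem_filter.1 hs).2]; simp
      · intro s hs
        rw [← (Finset.mem_filter.1 hs).2]; simp
    rw [hbij]
    exact Finset.sum_le_sum fun s _ => h s
  calc _ = ∑ _k : Fin n, ∑ s, (if s i = j then f s else 0) := by simp
    _ ≤ ∑ k : Fin n, ∑ s ∈ Finset.univ.filter (fun s : Fin m → Fin n => s i = k), g s :=
        Finset.sum_le_sum fun k _ => hk k
    _ = _ := Finset.sum_fiberwise Finset.univ (fun s : Fin m → Fin n => s i) g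

/-- Each of the `m` rows lands at `j` with probability 1/n, and moving it there turns `f` into
something below `g`. With the backlog at `j` as `f`, the same function serves as `g`: the backlog
depends only on arrivals before `j`, which the move cannot increase. -/
theorem unifExpect_arrivals_mul_le (hn : 0 < n) (j : Fin n) {f g : (Fin m → Fin n) → ℝ}
    (h : ∀ i s, f (Function.update s i j) ≤ g s) :
    unifExpect (fun s => arrivals (toStarts s) j * f s) ≤ m / n * unifExpect g := by
  have hn' : (0 : ℝ) < n := Nat.cast_pos.2 hn
  have h1 : ∀ s : Fin m → Fin n, arrivals (toStarts s) j * f s =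
      ∑ i, if s i = j then f s else 0 := by
    intro s
    rw [← card_filter_eq_arrivals, ← Finset.sum_filter, Finset.sum_const, nsmul_eq_mul]
  have h2 : ∀ i : Fin m, ∑ s : Fin m → Fin n, (if s i = j then f s else 0) ≤ (∑ s, g s) / n := by
    intro i
    rw [le_div_iff₀' hn']
    exact mul_sum_ite_le i j (h i)
  simp only [unifExpect, h1]
  rw [Finset.sum_comm, ← mul_div_assoc]
  refine div_le_div_of_nonneg_right ?_ (Nat.cast_nonneg _)
  refine (Finset.sum_le_sum fun i _ => h2 i).trans_eq ?_
  simp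
  ring

theorem arrivals_update_le (s : Fin m → Fin n) (i : Fin m) (j : Fin n) {k : ℕ} (hk : k ≠ j) :
    arrivals (toStarts (Function.update s i j)) k ≤ arrivals (toStarts s) k := by
  rw [arrivals, arrivals, startsIn, startsIn]
  refine Finset.card_le_card fun l hl => ?_
  simp only [Finset.mem_filter, Finset.mem_univ, true_and] at hl ⊢
  simp only [toStarts] at hl ⊢
  by_cases hli : l = i
  · subst hli
    simp only [Function.update_self] at hl
    omega
  · simpa [Function.update_of_ne hli] using hl

theorem arrivals_update_self_le (s : Fin m → Fin n) (i : Fin m) (j : Fin n) (k : ℕ) :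
    arrivals (toStarts (Function.update s i j)) k ≤ arrivals (toStarts s) k + 1 := by
  rw [arrivals, arrivals, startsIn, startsIn]
  refine (Finset.card_le_card (t := insert i (Finset.univ.filter fun l =>
    k ≤ toStarts s l ∧ toStarts s l < k + 1)) fun l hl => ?_).trans (Finset.card_insert_le _ _)
  simp only [Finset.mem_filter, Finset.mem_univ, true_and, Finset.mem_insert] at hl ⊢
  simp only [toStarts] at hl ⊢
  by_cases hli : l = i
  · exact Or.inl hli
  · right; simpa [Function.update_of_ne hli] using hl

theorem unifExpect_arrivals_le (hn : 0 < n) (j : Fin n) :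
    unifExpect (fun s : Fin m → Fin n => (arrivals (toStarts s) j : ℝ)) ≤ m / n := by
  have : NeZero n := ⟨hn.ne'⟩
  have := unifExpect_arrivals_mul_le (m := m) hn j (f := fun _ => 1) (g := fun _ => 1)
    fun _ _ => le_rfl
  simpa [unifExpect_const] using this

theorem unifExpect_arrivals_sq_le (hn : 0 < n) (j : Fin n) :
    unifExpect (fun s : Fin m → Fin n =>
      (arrivals (toStarts s) j : ℝ) * arrivals (toStarts s) j) ≤ m / n * (m / n + 1) := by
  have : NeZero n := ⟨hn.ne'⟩
  refine (unifExpect_arrivals_mul_le hn j (g := fun s => (arrivals (toStarts s) j : ℝ) + 1)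
    fun i s => by exact_mod_cast arrivals_update_self_le s i j j).trans ?_
  rw [unifExpect_add, unifExpect_const]
  gcongr
  exact unifExpect_arrivals_le hn j

theorem unifExpect_arrivals_mul_backlog_le (hn : 0 < n) (δ : ℝ) (j : Fin n) :
    unifExpect (fun s : Fin m → Fin n => arrivals (toStarts s) j * backlog δ (toStarts s) j) ≤
      m / n * unifExpect fun s : Fin m → Fin n => backlog δ (toStarts s) j :=
  unifExpect_arrivals_mul_le hn j fun i s =>
    backlog_mono δ fun _ hk => arrivals_update_le s i j hk.ne

/-- A randomly chosen row sees an average backlog of `O(1 / ε)`. -/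
theorem unifExpect_sum_arrivals_mul_le {ε : ℝ} (h0 : 0 < ε) (h1 : ε < 1) (hn : 0 < n)
    (hmn : (m : ℝ) ≤ (1 - ε) * n) :
    unifExpect (fun s : Fin m → Fin n => ∑ j ∈ Finset.range n,
      (arrivals (toStarts s) j : ℝ) * (arrivals (toStarts s) j + backlog (ε / 2) (toStarts s) j)) ≤
      5 * (m / ε) := by
  have hn' : (0 : ℝ) < n := Nat.cast_pos.2 hn
  have : NeZero n := ⟨hn.ne'⟩
  have hρ : (m : ℝ) / n ≤ 1 - ε := (div_le_iff₀ hn').2 hmn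
  have hρ0 : (0 : ℝ) ≤ m / n := by positivity
  set Q := ∑ j ∈ Finset.range n,
    unifExpect fun s : Fin m → Fin n => backlog (ε / 2) (toStarts s) j with hQ
  set R := ∑ j ∈ Finset.range n, unifExpect fun s : Fin m → Fin n =>
    (arrivals (toStarts s) j : ℝ) * backlog (ε / 2) (toStarts s) j with hR
  set V := ∑ j ∈ Finset.range n, unifExpect fun s : Fin m → Fin n =>
    (arrivals (toStarts s) j : ℝ) * arrivals (toStarts s) j with hV
  have hQ0 : 0 ≤ Q := Finset.sum_nonneg fun j _ => unifExpect_nonneg fun s => backlog_nonneg _ _ _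
  have hRQ : R ≤ m / n * Q := by
    rw [hR, hQ, Finset.mul_sum]
    exact Finset.sum_le_sum fun j hj =>
      unifExpect_arrivals_mul_backlog_le hn _ ⟨j, Finset.mem_range.1 hj⟩
  have hV2 : V ≤ 2 * m := by
    refine (Finset.sum_le_card_nsmul _ _ (m / n * (m / n + 1) : ℝ) fun j hj =>
      unifExpect_arrivals_sq_le hn ⟨j, Finset.mem_range.1 hj⟩).trans ?_
    rw [Finset.card_range, nsmul_eq_mul, ← mul_assoc, mul_div_cancel₀ _ hn'.ne']
    nlinarith [(Nat.cast_nonneg m : (0 : ℝ) ≤ m)]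
  have hlyap : 2 * (1 - ε / 2) * Q ≤ 2 * R + V + n := by
    have := unifExpect_mono (Ω := Fin m → Fin n) fun s =>
      sum_backlog_le (δ := ε / 2) (by linarith) (by linarith) (toStarts s) n
    rwa [unifExpect_mul_left, unifExpect_add, unifExpect_add, unifExpect_mul_left, unifExpect_const,
      unifExpect_sum, unifExpect_sum, unifExpect_sum] at this
  -- By `hRQ`, `2 * R` is at most 2(1-ε)Q. Subtracting it from (2-ε)Q leaves εQ, bounded by V + n ≤
  -- 2m + n.
  have hQle : ε * Q ≤ 3 * n := by nlinarith
  have hRle : R ≤ 3 * (m / ε) := by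
    have : R * ε ≤ 3 * m := by
      calc R * ε ≤ m / n * Q * ε := by gcongr
        _ = m / n * (ε * Q) := by ring
        _ ≤ m / n * (3 * n) := by gcongr
        _ = 3 * m := by field_simp
    rw [← mul_div_assoc]
    exact (le_div_iff₀ h0).2 this
  have hm : (m : ℝ) ≤ m / ε := by
    rw [le_div_iff₀ h0]
    nlinarith [(Nat.cast_nonneg m : (0 : ℝ) ≤ m)]
  have hsum : unifExpect (fun s : Fin m → Fin n => ∑ j ∈ Finset.range n,
      (arrivals (toStarts s) j : ℝ) * (arrivals (toStarts s) j + backlog (ε / 2) (toStarts s) j)) =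
      V + R := by
    simp only [mul_add]
    rw [unifExpect_sum, hV, hR, ← Finset.sum_add_distrib]
    exact Finset.sum_congr rfl fun j _ => unifExpect_add _ _
  rw [hsum]
  linarith

end Starts

end SGauss

namespace SGauss

/-! ### Success probability and expected number of row additions -/

theorem unifExpect_card_spanDependencies_le {m L : ℕ} (s : Fin m → ℕ) (p r q : ℕ) :
    unifExpect (fun β : Fin m → Fin L → ZMod 2 => ((spanDependencies s β p r q).card : ℝ)) ≤
      2 ^ startsIn s p r / 2 ^ (q - p) := by
  have hcard : (0 : ℝ) < Fintype.card (Fin m → Fin L → ZMod 2) :=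
    Nat.cast_pos.2 Fintype.card_pos
  rw [unifExpect, div_le_div_iff₀ hcard (by positivity)]
  exact_mod_cast sum_card_spanDependencies_mul_le s p r q

/-- Truncation allows a small exponent: min(1, x) ≤ x^θ for 0 ≤ θ ≤ 1. Without it the mean of 2^X
could be of order e^((1-ε)y), which exceeds 2^y for small ε. -/
theorem min_one_two_pow_div_le {t : ℝ} (h0 : 0 ≤ t) (h1 : t ≤ Real.log 2) (a q : ℕ) :
    min 1 ((2 : ℝ) ^ a / 2 ^ q) ≤ Real.exp (t * a - t * q) := by
  rcases le_total q a with h | h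
  · refine (min_le_left _ _).trans (Real.one_le_exp ?_)
    have : (q : ℝ) ≤ a := Nat.cast_le.2 h
    nlinarith
  · refine (min_le_right _ _).trans ?_
    have h2 : ∀ k : ℕ, (2 : ℝ) ^ k = Real.exp (k * Real.log 2) := fun k => by
      rw [Real.exp_nat_mul, Real.exp_log two_pos]
    rw [h2, h2, ← Real.exp_sub]
    have : (a : ℝ) ≤ q := Nat.cast_le.2 h
    refine Real.exp_le_exp.2 ?_
    nlinarith

theorem unifExpect_exp_startsIn_sub_le {m n : ℕ} {ε : ℝ} (h0 : 0 < ε) (h1 : ε < 1) (hn : 0 < n)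
    (hmn : (m : ℝ) ≤ (1 - ε) * n) (p y : ℕ) :
    unifExpect (fun s : Fin m → Fin n =>
      Real.exp (ε / 2 * startsIn (toStarts s) p (p + y))) ≤ Real.exp (ε / 2 * y) := by
  refine (unifExpect_exp_startsIn_le (by linarith) hn p y).trans (Real.exp_le_exp.2 ?_)
  have hn' : (0 : ℝ) < n := Nat.cast_pos.2 hn
  have hρ : (m : ℝ) / n ≤ 1 - ε := (div_le_iff₀ hn').2 hmn
  have hy : (0 : ℝ) ≤ y := Nat.cast_nonneg y
  have he : Real.exp (ε / 2) - 1 ≤ ε / 2 + (ε / 2) ^ 2 := by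
    have := (abs_le.1 (Real.abs_exp_sub_one_sub_id_le (x := ε / 2)
      (by rw [abs_of_pos (by linarith)]; linarith))).2
    linarith
  have he0 : 0 ≤ Real.exp (ε / 2) - 1 := sub_nonneg.2 (Real.one_le_exp (by linarith))
  calc (m : ℝ) / n * y * (Real.exp (ε / 2) - 1)
      ≤ (1 - ε) * y * (ε / 2 + (ε / 2) ^ 2) := by
        apply mul_le_mul _ he he0 (mul_nonneg (by linarith) hy)
        exact mul_le_mul_of_nonneg_right hρ hy
    -- The gap ε in the density outweighs the second-order term of the exponential, since
    -- (1-ε)(1+ε/2) ≤ 1.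
    _ = ((1 - ε) * (1 + ε / 2)) * (ε / 2 * y) := by ring
    _ ≤ 1 * (ε / 2 * y) := by
        apply mul_le_mul_of_nonneg_right _ (by positivity)
        nlinarith
    _ = ε / 2 * y := one_mul _

theorem unifProb_not_rowsIndep_le {m n L : ℕ} {ε : ℝ} (h0 : 0 < ε) (h1 : ε < 1) (hL : 1 ≤ L)
    (hn : 0 < n) (hmn : (m : ℝ) ≤ (1 - ε) * n) :
    unifProb (fun ω : Sample m n L => ¬ RowsIndep (bandMatrix ω)) ≤
      (n : ℝ) ^ 2 * Real.exp (-(ε / 2 * (L - 1))) := by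
  classical
  have ht : ε / 2 ≤ Real.log 2 := by have := Real.log_two_gt_d9; linarith
  have hpt : ∀ ω : Sample m n L, (if ¬ RowsIndep (bandMatrix ω) then (1 : ℝ) else 0) ≤
      ∑ p ∈ Finset.range n, ∑ y ∈ Finset.Icc 1 n, min 1
        ((spanDependencies (starts ω) (fun i => (ω i).2) p (p + y) (p + (y + L - 1))).card : ℝ) := by
    intro ω
    have hnn : ∀ p y, (0 : ℝ) ≤ min 1
        ((spanDependencies (starts ω) (fun i => (ω i).2) p (p + y) (p + (y + L - 1))).card : ℝ) :=
      fun p y => le_min zero_le_one (Nat.cast_nonneg _)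
    split_ifs with h
    · exact Finset.sum_nonneg fun p _ => Finset.sum_nonneg fun y _ => hnn p y
    · obtain ⟨p, hp, y, hy1, hy2, hne⟩ := exists_spanDependency_of_not_rowsIndep hL ω h
      refine le_trans ?_ (Finset.single_le_sum
        (fun p _ => Finset.sum_nonneg fun y _ => hnn p y) (Finset.mem_range.2 hp))
      refine le_trans ?_ (Finset.single_le_sum
        (fun y _ => hnn p y) (Finset.mem_Icc.2 ⟨hy1, hy2⟩))
      refine le_min le_rfl ?_
      exact_mod_cast Finset.card_pos.2 hne
  rw [unifProb_eq_unifExpect]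
  refine (unifExpect_mono hpt).trans ?_
  rw [unifExpect_sum]
  have hterm : ∀ p, ∀ y ∈ Finset.Icc 1 n, unifExpect (fun ω : Sample m n L => min (1 : ℝ)
      ((spanDependencies (starts ω) (fun i => (ω i).2) p (p + y) (p + (y + L - 1))).card : ℝ)) ≤
      Real.exp (-(ε / 2 * (L - 1))) := by
    intro p y hy
    rw [unifExpect_sample]
    calc _ ≤ unifExpect fun s : Fin m → Fin n => Real.exp (-(ε / 2 * (y + L - 1))) *
            Real.exp (ε / 2 * startsIn (toStarts s) p (p + y)) := by
          refine unifExpect_mono fun s => ?_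
          -- The bits are averaged with the starts fixed, and only this conditional mean is
          -- truncated at 1. The factors depending on `y` then cancel against the moment bound, and
          -- the L - 1 extra columns remain.
          have hE : unifExpect (fun β : Fin m → Fin L → ZMod 2 => min (1 : ℝ)
              ((spanDependencies (toStarts s) β p (p + y) (p + (y + L - 1))).card : ℝ)) ≤
              min 1 (2 ^ startsIn (toStarts s) p (p + y) / 2 ^ (y + L - 1)) := by
            refine le_min ?_ ?_
            · exact (unifExpect_mono fun β => min_le_left _ _).trans_eq (unifExpect_const 1)
            · refine (unifExpect_mono fun β => min_le_right _ _).trans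
                ((unifExpect_card_spanDependencies_le _ _ _ _).trans_eq ?_)
              rw [Nat.add_sub_cancel_left]
          refine hE.trans ((min_one_two_pow_div_le (by linarith) ht _ _).trans_eq ?_)
          rw [← Real.exp_add]
          congr 1
          rw [Nat.cast_sub (by omega)]
          push_cast
          ring
      _ ≤ Real.exp (-(ε / 2 * (y + L - 1))) * Real.exp (ε / 2 * y) := by
          rw [unifExpect_mul_left]
          gcongr
          exact unifExpect_exp_startsIn_sub_le h0 h1 hn hmn p y
      _ = _ := by
          rw [← Real.exp_add]
          congr 1
          ring
  calc _ ≤ ∑ p ∈ Finset.range n, ∑ y ∈ Finset.Icc 1 n, Real.exp (-(ε / 2 * (L - 1))) := by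
        refine Finset.sum_le_sum fun p _ => ?_
        rw [unifExpect_sum]
        exact Finset.sum_le_sum fun y hy => hterm p y hy
    _ = _ := by
        simp only [Finset.sum_const, Finset.card_range, Nat.card_Icc, nsmul_eq_mul,
          Nat.add_sub_cancel]
        ring

theorem le_two_rpow {x : ℝ} (hx : 0 ≤ x) : x ≤ (2 : ℝ) ^ x := by
  rcases le_total x 1 with h | h
  · exact h.trans (Real.one_le_rpow one_le_two hx)
  · have := one_add_mul_self_le_rpow_one_add (s := 1) (by norm_num) h
    norm_num at this
    linarith

theorem sum_two_pow_startsIn_div_le {m : ℕ} {ε : ℝ} (h0 : 0 < ε) (h1 : ε < 1) (s : Fin m → ℕ)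
    (j : ℕ) : ∑ p ∈ Finset.range (j + 1), (2 : ℝ) ^ startsIn s p j / 2 ^ (j - p) ≤
      2 ^ (backlog (ε / 2) s j + 4 / ε) := by
  set r : ℝ := 2 ^ (-(ε / 2)) with hr
  have hr0 : 0 < r := Real.rpow_pos_of_pos two_pos _
  have hr1 : r ≤ 1 - ε / 4 := by
    have h2 := rpow_one_add_le_one_add_mul_self (s := -(1 / 2)) (by norm_num) (p := ε / 2)
      (by linarith) (by linarith)
    -- Bernoulli's inequality for exponents at most 1: (1 - 1/2)^(ε/2) ≤ 1 - ε/4. The geometric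
    -- series is then at most 4/ε.
    have h3 : r = (1 + -(1 / 2) : ℝ) ^ (ε / 2) := by
      rw [hr, Real.rpow_neg two_pos.le, ← Real.inv_rpow two_pos.le]
      norm_num
    rw [h3]
    linarith
  have hterm : ∀ p ∈ Finset.range (j + 1), (2 : ℝ) ^ startsIn s p j / 2 ^ (j - p) ≤
      2 ^ backlog (ε / 2) s j * r ^ (j - p) := by
    intro p hp
    have hpj : p ≤ j := Nat.lt_succ_iff.1 (Finset.mem_range.1 hp)
    have hle := startsIn_le_backlog (ε / 2) s hpj
    rw [← Real.rpow_natCast, ← Real.rpow_natCast, ← Real.rpow_sub two_pos, hr,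
      ← Real.rpow_natCast, ← Real.rpow_mul two_pos.le, ← Real.rpow_add two_pos]
    refine Real.rpow_le_rpow_of_exponent_le one_le_two ?_
    rw [Nat.cast_sub hpj]
    linarith
  have hgeom : ∑ p ∈ Finset.range (j + 1), r ^ (j - p) ≤ 4 / ε := by
    rw [Finset.sum_flip (fun k => r ^ k)]
    have hr1' : r < 1 := by linarith
    refine ((summable_geometric_of_lt_one hr0.le hr1').sum_le_tsum _
      fun k _ => pow_nonneg hr0.le k).trans ?_
    rw [tsum_geometric_of_lt_one hr0.le hr1', ← one_div, div_le_div_iff₀ (by linarith) h0]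
    linarith
  calc _ ≤ ∑ p ∈ Finset.range (j + 1), 2 ^ backlog (ε / 2) s j * r ^ (j - p) :=
        Finset.sum_le_sum hterm
    _ = 2 ^ backlog (ε / 2) s j * ∑ p ∈ Finset.range (j + 1), r ^ (j - p) :=
        (Finset.mul_sum _ _ _).symm
    _ ≤ 2 ^ backlog (ε / 2) s j * 2 ^ (4 / ε) := by
        gcongr
        -- Bounding the factor 4/ε by 2^(4/ε) is wasteful but costs each row only 4/ε additions, the
        -- order aimed at anyway.
        exact hgeom.trans (le_two_rpow (by positivity))
    _ = _ := (Real.rpow_add two_pos _ _).symm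

/-- The number of span dependencies ending at `j`, normalized to have expectation at most `1`. -/
noncomputable def dependencyExcess {m L : ℕ} (ε : ℝ) (s : Fin m → ℕ) (β : Fin m → Fin L → ZMod 2)
    (j : ℕ) : ℝ :=
  2 ^ (-(backlog (ε / 2) s j + 4 / ε)) *
    ∑ p ∈ Finset.range (j + 1), ((spanDependencies s β p j j).card : ℝ)

theorem dependencyExcess_nonneg {m L : ℕ} (ε : ℝ) (s : Fin m → ℕ) (β : Fin m → Fin L → ZMod 2)
    (j : ℕ) : 0 ≤ dependencyExcess ε s β j :=
  mul_nonneg (Real.rpow_nonneg two_pos.le _) (Finset.sum_nonneg fun _ _ => Nat.cast_nonneg _)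

theorem unifExpect_dependencyExcess_le {m L : ℕ} {ε : ℝ} (h0 : 0 < ε) (h1 : ε < 1)
    (s : Fin m → ℕ) (j : ℕ) :
    unifExpect (fun β : Fin m → Fin L → ZMod 2 => dependencyExcess ε s β j) ≤ 1 := by
  simp only [dependencyExcess]
  rw [unifExpect_mul_left, unifExpect_sum, Real.rpow_neg two_pos.le]
  have hpos : (0 : ℝ) < 2 ^ (backlog (ε / 2) s j + 4 / ε) := Real.rpow_pos_of_pos two_pos _
  rw [inv_mul_le_iff₀ hpos, mul_one]
  exact (Finset.sum_le_sum fun p _ => unifExpect_card_spanDependencies_le s p j j).trans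
    (sum_two_pow_startsIn_div_le h0 h1 s j)

theorem length_rowAdditions_le {m n L : ℕ} {ε : ℝ} (ω : Sample m n L)
    (h : RowsIndep (bandMatrix ω)) (b : Fin m → ZMod 2) :
    ((rowAdditions L (starts ω) (bandMatrix ω) b).length : ℝ) ≤
      ∑ i, ((arrivals (starts ω) (starts ω i) + backlog (ε / 2) (starts ω) (starts ω i)) + 4 / ε +
        dependencyExcess ε (starts ω) (fun i => (ω i).2) (starts ω i)) := by
  obtain ⟨r, hr, hker⟩ := exists_length_rowAdditions_le (blockSupported_bandMatrix ω) b
  have hr' : ((rowAdditions L (starts ω) (bandMatrix ω) b).length : ℝ) ≤ ∑ i, (r i : ℝ) := by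
    exact_mod_cast hr
  refine hr'.trans (Finset.sum_le_sum fun i _ => ?_)
  have hle := (hker i).trans (card_prefixKernel_le ω h (starts_lt ω i))
  set j := starts ω i
  rw [← arrivals] at hle
  set κ := backlog (ε / 2) (starts ω) j + 4 / ε with hκ
  have hX : 0 ≤ dependencyExcess ε (starts ω) (fun i => (ω i).2) j := dependencyExcess_nonneg _ _ _ _
  suffices hs : (r i : ℝ) - arrivals (starts ω) j - κ ≤
      dependencyExcess ε (starts ω) (fun i => (ω i).2) j by rw [hκ] at hs; linarith
  by_cases hneg : (r i : ℝ) - arrivals (starts ω) j - κ ≤ 0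
  · exact hneg.trans hX
  -- The inequality x ≤ 2^x replaces taking logarithms: what exceeds arrivals + κ is paid for by the
  -- normalized count, whose mean over the bits is at most 1.
  refine (le_two_rpow (not_le.1 hneg).le).trans ?_
  rw [dependencyExcess, ← hκ, Real.rpow_sub two_pos, Real.rpow_sub two_pos, Real.rpow_neg two_pos.le,
    mul_comm, ← div_eq_mul_inv, Real.rpow_natCast, Real.rpow_natCast]
  gcongr
  rw [div_le_iff₀' (by positivity)]
  exact_mod_cast hle

theorem unifExpect_length_rowAdditions_le {m n L : ℕ} {ε : ℝ} (h0 : 0 < ε) (h1 : ε < 1)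
    (hn : 0 < n) (hmn : (m : ℝ) ≤ (1 - ε) * n) (b : Fin m → ZMod 2) :
    unifExpect (fun ω : Sample m n L =>
      ((rowAdditions L (starts ω) (bandMatrix ω) b).length : ℝ)) ≤
      (m : ℝ) ^ 2 * unifProb (fun ω : Sample m n L => ¬ RowsIndep (bandMatrix ω)) +
        10 * (m / ε) := by
  classical
  have : NeZero n := ⟨hn.ne'⟩
  have hpt : ∀ ω : Sample m n L, ((rowAdditions L (starts ω) (bandMatrix ω) b).length : ℝ) ≤
      (m : ℝ) ^ 2 * (if ¬ RowsIndep (bandMatrix ω) then (1 : ℝ) else 0) +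
      ∑ i, ((arrivals (starts ω) (starts ω i) + backlog (ε / 2) (starts ω) (starts ω i)) + 4 / ε +
        dependencyExcess ε (starts ω) (fun i => (ω i).2) (starts ω i)) := by
    intro ω
    split_ifs with h
    · simpa using length_rowAdditions_le ω h b
    · have h2 : ((rowAdditions L (starts ω) (bandMatrix ω) b).length : ℝ) ≤ (m : ℝ) ^ 2 := by
        exact_mod_cast length_rowAdditions_le_sq (blockSupported_bandMatrix ω) b
      rw [mul_one]
      refine h2.trans (le_add_of_nonneg_right (Finset.sum_nonneg fun i _ => ?_))
      have := backlog_nonneg (ε / 2) (starts ω) (starts ω i)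
      have := dependencyExcess_nonneg ε (starts ω) (fun i => (ω i).2) (starts ω i)
      positivity
  refine (unifExpect_mono hpt).trans ?_
  rw [unifExpect_add, unifExpect_mul_left, ← unifProb_eq_unifExpect]
  gcongr
  rw [unifExpect_sample]
  calc _ ≤ unifExpect fun s : Fin m → Fin n => (∑ j ∈ Finset.range n,
          (arrivals (toStarts s) j : ℝ) *
            (arrivals (toStarts s) j + backlog (ε / 2) (toStarts s) j)) + m * (4 / ε + 1) := by
        refine unifExpect_mono fun s => ?_
        rw [← sum_starts_eq s fun j =>
          (arrivals (toStarts s) j : ℝ) + backlog (ε / 2) (toStarts s) j]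
        change unifExpect (fun β : Fin m → Fin L → ZMod 2 => ∑ i, (((arrivals (toStarts s) (s i) : ℝ)
          + backlog (ε / 2) (toStarts s) (s i)) + 4 / ε +
            dependencyExcess ε (toStarts s) β (s i))) ≤ _
        rw [unifExpect_sum]
        have hi : ∀ i ∈ (Finset.univ : Finset (Fin m)),
            unifExpect (fun β : Fin m → Fin L → ZMod 2 => ((arrivals (toStarts s) (s i) : ℝ)
              + backlog (ε / 2) (toStarts s) (s i)) + 4 / ε +
              dependencyExcess ε (toStarts s) β (s i)) ≤
            ((arrivals (toStarts s) (s i) : ℝ) + backlog (ε / 2) (toStarts s) (s i)) +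
              (4 / ε + 1) := by
          intro i _
          rw [unifExpect_add, unifExpect_const, add_assoc]
          gcongr
          exact unifExpect_dependencyExcess_le h0 h1 _ _
        refine (Finset.sum_le_sum hi).trans_eq ?_
        rw [Finset.sum_add_distrib]
        simp
        ring
    _ ≤ 5 * (m / ε) + m * (4 / ε + 1) := by
        rw [unifExpect_add, unifExpect_const]
        gcongr
        exact unifExpect_sum_arrivals_mul_le h0 h1 hn hmn
    _ ≤ 10 * (m / ε) := by
        have hm : (m : ℝ) ≤ m / ε := by
          rw [le_div_iff₀ h0]
          nlinarith [(Nat.cast_nonneg m : (0 : ℝ) ≤ m)]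
        have : (m : ℝ) * (4 / ε + 1) = 4 * (m / ε) + m := by ring
        linarith

end SGauss

namespace WordRAM

/-! ### Running programs -/

section Run

variable {w : ℕ} {P : Program}

@[simp] theorem State.setReg_pc (σ : State w) (d : ℕ) (v : BitVec w) :
    (σ.setReg d v).pc = σ.pc + 1 := rfl

@[simp] theorem State.setReg_reg (σ : State w) (d : ℕ) (v : BitVec w) (k : ℕ) :
    (σ.setReg d v).reg k = if k = d then v else σ.reg k := by
  simp [State.setReg, Function.update_apply]

@[simp] theorem State.setReg_mem (σ : State w) (d : ℕ) (v : BitVec w) :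
    (σ.setReg d v).mem = σ.mem := rfl

/-- The program reaches `τ` from `σ` in `t` steps, without halting before. -/
def Reaches (P : Program) (σ : State w) (t : ℕ) (τ : State w) : Prop :=
  (step P)^[t] σ = τ ∧ ∀ t' < t, ((step P)^[t'] σ).pc < P.length

theorem Reaches.refl (σ : State w) : Reaches P σ 0 σ := ⟨rfl, fun _ h => absurd h (Nat.not_lt_zero _)⟩

theorem Reaches.trans {σ τ υ : State w} {t u : ℕ} (h : Reaches P σ t τ) (h' : Reaches P τ u υ) :
    Reaches P σ (t + u) υ := by
  obtain ⟨h1, h2⟩ := h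
  obtain ⟨h1', h2'⟩ := h'
  refine ⟨by rw [add_comm, Function.iterate_add_apply, h1, h1'], fun t' ht' => ?_⟩
  by_cases hlt : t' < t
  · exact h2 t' hlt
  · obtain ⟨d, rfl⟩ := Nat.exists_eq_add_of_le (not_lt.1 hlt)
    rw [add_comm, Function.iterate_add_apply, h1]
    exact h2' d (by omega)

theorem Reaches.head {σ τ : State w} {t : ℕ} (I : Instr) (hI : P[σ.pc]? = some I)
    (h : Reaches P (I.exec σ) t τ) : Reaches P σ (t + 1) τ := by
  have hstep : step P σ = I.exec σ := by simp [step, hI]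
  obtain ⟨h1, h2⟩ := h
  refine ⟨by rw [Function.iterate_succ_apply, hstep, h1], fun t' ht' => ?_⟩
  cases t' with
  | zero => exact (List.getElem?_eq_some_iff.1 hI).1
  | succ t' =>
    rw [Function.iterate_succ_apply, hstep]
    exact h2 t' (by omega)

end Run

/-! ### The row addition program -/

/-- The program for a row addition. Registers: `0`, `1` are the addresses of the current words of
the two rows, `2` counts the remaining words, `4` holds the constant `1`, and `6` holds the distance
of the starting positions, reduced by the word length in the first loop. -/
def rowAdditionProgram : Program :=
  [.const 4 1, .load 5 0, .load 6 1, .bin .sub 6 6 5, .bin .add 0 0 4, .bin .add 1 1 4,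
   .load 5 0, .load 7 1, .bin .xor 7 7 5, .store 1 7, .bin .add 0 0 4, .bin .add 1 1 4,
   .jumpLt 6 3 17, .bin .sub 6 6 3, .bin .add 0 0 4, .bin .sub 2 2 4, .jump 12,
   .bin .sub 3 3 6,
   .load 5 0, .bin .shr 5 5 6, .load 7 1, .bin .xor 7 7 5, .store 1 7, .bin .add 0 0 4,
   .bin .sub 2 2 4, .jumpZero 2 33,
   .load 5 0, .bin .shl 5 5 3, .load 7 1, .bin .xor 7 7 5, .store 1 7, .bin .add 1 1 4, .jump 18]

section Program

variable {w : ℕ}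

theorem reaches_prelude (σ : State w) (h : σ.pc = 0) :
    ∃ τ, Reaches rowAdditionProgram σ 12 τ ∧ τ.pc = 12 ∧
      τ.reg 0 = σ.reg 0 + BitVec.ofNat w 1 + BitVec.ofNat w 1 ∧
      τ.reg 1 = σ.reg 1 + BitVec.ofNat w 1 + BitVec.ofNat w 1 ∧
      τ.reg 2 = σ.reg 2 ∧ τ.reg 3 = σ.reg 3 ∧ τ.reg 4 = BitVec.ofNat w 1 ∧
      τ.reg 6 = σ.mem (σ.reg 1) - σ.mem (σ.reg 0) ∧
      τ.mem = Function.update σ.mem (σ.reg 1 + BitVec.ofNat w 1)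
        (σ.mem (σ.reg 1 + BitVec.ofNat w 1) ^^^ σ.mem (σ.reg 0 + BitVec.ofNat w 1)) := by
  obtain ⟨pc, reg, mem⟩ := σ
  subst h
  refine ⟨_, .head (.const 4 1) rfl <| .head (.load 5 0) rfl <| .head (.load 6 1) rfl <|
    .head (.bin .sub 6 6 5) rfl <| .head (.bin .add 0 0 4) rfl <| .head (.bin .add 1 1 4) rfl <|
    .head (.load 5 0) rfl <| .head (.load 7 1) rfl <| .head (.bin .xor 7 7 5) rfl <|
    .head (.store 1 7) rfl <| .head (.bin .add 0 0 4) rfl <| .head (.bin .add 1 1 4) rfl <|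
    .refl _, rfl, ?_⟩
  simp [Instr.exec, BinOp.eval]

/-- Division with remainder by repeated subtraction of the word length. Each round moves past one
source word and lowers the count of remaining words; the last two steps leave the complementary
shift in register 3. -/
theorem reaches_reduce_shift (hw : 0 < w) (q : ℕ) (σ : State w) (h : σ.pc = 12)
    (hq : (σ.reg 6).toNat / w = q) (h3 : σ.reg 3 = BitVec.ofNat w w)
    (h4 : σ.reg 4 = BitVec.ofNat w 1) :
    ∃ t τ, t ≤ 5 * q + 2 ∧ Reaches rowAdditionProgram σ t τ ∧ τ.pc = 18 ∧
      τ.reg 0 = σ.reg 0 + BitVec.ofNat w q ∧ τ.reg 1 = σ.reg 1 ∧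
      τ.reg 2 = σ.reg 2 - BitVec.ofNat w q ∧
      τ.reg 3 = BitVec.ofNat w w - τ.reg 6 ∧
      τ.reg 4 = BitVec.ofNat w 1 ∧ (τ.reg 6).toNat = (σ.reg 6).toNat % w ∧ τ.mem = σ.mem := by
  have hwlt : w % 2 ^ w = w := Nat.mod_eq_of_lt Nat.lt_two_pow_self
  induction q generalizing σ with
  | zero =>
    have hlt : (σ.reg 6).toNat < w := by
      rcases Nat.div_eq_zero_iff.1 hq with h | h
      · omega
      · exact h
    obtain ⟨pc, reg, mem⟩ := σ
    simp only at h hq h3 h4 hlt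
    subst h
    refine ⟨2, _, by omega, .head (.jumpLt 6 3 17) rfl <| .head (.bin .sub 3 3 6) ?_ <| .refl _, ?_⟩
    · simp [Instr.exec, h3, hwlt, hlt, rowAdditionProgram]
    · simp [Instr.exec, BinOp.eval, h3, h4, hwlt, hlt, Nat.mod_eq_of_lt hlt]
  | succ q ih =>
    have hge : w ≤ (σ.reg 6).toNat := by
      by_contra hlt
      rw [Nat.div_eq_of_lt (not_le.1 hlt)] at hq
      omega
    obtain ⟨pc, reg, mem⟩ := σ
    simp only at h hq h3 h4 hge ih
    subst h
    have hsub : (reg 6 - reg 3).toNat = (reg 6).toNat - w := by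
      rw [h3, BitVec.toNat_sub_of_le]
      · simp [hwlt]
      · rw [BitVec.le_def]; simpa [hwlt] using hge
    have hrun : ∃ τ, Reaches rowAdditionProgram ⟨12, reg, mem⟩ 5 τ ∧ τ.pc = 12 ∧
        τ.reg 0 = reg 0 + BitVec.ofNat w 1 ∧ τ.reg 1 = reg 1 ∧ τ.reg 2 = reg 2 - BitVec.ofNat w 1 ∧
        τ.reg 3 = reg 3 ∧ τ.reg 4 = reg 4 ∧ τ.reg 6 = reg 6 - reg 3 ∧ τ.mem = mem := by
      refine ⟨_, .head (.jumpLt 6 3 17) rfl <| .head (.bin .sub 6 6 3) ?_ <|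
        .head (.bin .add 0 0 4) ?_ <| .head (.bin .sub 2 2 4) ?_ <| .head (.jump 12) ?_ <| .refl _, ?_⟩
      all_goals simp [Instr.exec, BinOp.eval, h3, h4, hwlt, not_lt.2 hge, rowAdditionProgram]
    obtain ⟨τ, hr, hpc, r0, r1, r2, r3, r4, r6, hm⟩ := hrun
    have hq' : (τ.reg 6).toNat / w = q := by
      rw [r6, hsub]
      have := Nat.div_eq_sub_div hw hge
      omega
    obtain ⟨t, υ, ht, hr', hpc', s0, s1, s2, s3, s4, s6, hm'⟩ :=
      ih τ hpc hq' (r3.trans h3) (r4.trans h4)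
    refine ⟨5 + t, υ, by omega, hr.trans hr', hpc', ?_, s1.trans r1, ?_, s3, s4, ?_, hm'.trans hm⟩
    · simp only [s0, r0]
      rw [BitVec.add_assoc, ← BitVec.ofNat_add, Nat.add_comm 1 q]
    · simp only [s2, r2]
      rw [Nat.add_comm q 1, BitVec.ofNat_add, BitVec.sub_sub]
    · rw [s6, r6, hsub, ← Nat.mod_eq_sub_mod hge]

theorem reaches_xor_last (σ : State w) (h : σ.pc = 18) (h2 : σ.reg 2 = BitVec.ofNat w 1)
    (h4 : σ.reg 4 = BitVec.ofNat w 1) :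
    ∃ τ, Reaches rowAdditionProgram σ 8 τ ∧ τ.pc = 33 ∧
      τ.mem = Function.update σ.mem (σ.reg 1)
        (σ.mem (σ.reg 1) ^^^ (σ.mem (σ.reg 0) >>> (σ.reg 6).toNat)) := by
  obtain ⟨pc, reg, mem⟩ := σ
  simp only at h h2 h4
  subst h
  refine ⟨_, .head (.load 5 0) rfl <| .head (.bin .shr 5 5 6) rfl <| .head (.load 7 1) rfl <|
    .head (.bin .xor 7 7 5) rfl <| .head (.store 1 7) rfl <| .head (.bin .add 0 0 4) rfl <|
    .head (.bin .sub 2 2 4) rfl <| .head (.jumpZero 2 33) rfl <| .refl _, ?_⟩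
  simp [Instr.exec, BinOp.eval, h2, h4]

/-- A target word takes bits from two adjacent source words and is stored twice. By `hne` the first
store does not touch the source word read next. -/
theorem reaches_xor_word (σ : State w) (h : σ.pc = 18) (h2 : σ.reg 2 ≠ BitVec.ofNat w 1)
    (h4 : σ.reg 4 = BitVec.ofNat w 1) (hne : σ.reg 0 + BitVec.ofNat w 1 ≠ σ.reg 1) :
    ∃ τ, Reaches rowAdditionProgram σ 15 τ ∧ τ.pc = 18 ∧
      τ.reg 0 = σ.reg 0 + BitVec.ofNat w 1 ∧ τ.reg 1 = σ.reg 1 + BitVec.ofNat w 1 ∧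
      τ.reg 2 = σ.reg 2 - BitVec.ofNat w 1 ∧ τ.reg 3 = σ.reg 3 ∧ τ.reg 4 = σ.reg 4 ∧
      τ.reg 6 = σ.reg 6 ∧ τ.mem = Function.update σ.mem (σ.reg 1)
        (σ.mem (σ.reg 1) ^^^ (σ.mem (σ.reg 0) >>> (σ.reg 6).toNat) ^^^
          (σ.mem (σ.reg 0 + BitVec.ofNat w 1) <<< (σ.reg 3).toNat)) := by
  obtain ⟨pc, reg, mem⟩ := σ
  simp only at h h2 h4 hne
  subst h
  have h2' : ¬ reg 2 - BitVec.ofNat w 1 = 0#w := fun hh => h2 (sub_eq_zero.1 hh)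
  refine ⟨_, .head (.load 5 0) rfl <| .head (.bin .shr 5 5 6) rfl <| .head (.load 7 1) rfl <|
    .head (.bin .xor 7 7 5) rfl <| .head (.store 1 7) rfl <| .head (.bin .add 0 0 4) rfl <|
    .head (.bin .sub 2 2 4) rfl <| .head (.jumpZero 2 33) rfl <| .head (.load 5 0) ?_ <|
    .head (.bin .shl 5 5 3) ?_ <| .head (.load 7 1) ?_ <| .head (.bin .xor 7 7 5) ?_ <|
    .head (.store 1 7) ?_ <| .head (.bin .add 1 1 4) ?_ <| .head (.jump 18) ?_ <| .refl _, ?_⟩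
  all_goals simp [Instr.exec, BinOp.eval, h4, h2', hne, rowAdditionProgram]

theorem ofNat_add_one (x : ℕ) : BitVec.ofNat w x + BitVec.ofNat w 1 = BitVec.ofNat w (x + 1) :=
  (BitVec.ofNat_add x 1).symm

theorem ofNat_ne_ofNat {x y : ℕ} (hx : x < 2 ^ w) (hy : y < 2 ^ w) (h : x ≠ y) :
    BitVec.ofNat w x ≠ BitVec.ofNat w y := fun hh => h <| by
  have := congrArg BitVec.toNat hh
  rwa [BitVec.toNat_ofNat, BitVec.toNat_ofNat, Nat.mod_eq_of_lt hx, Nat.mod_eq_of_lt hy] at this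

theorem eq_ofNat_iff {z : BitVec w} {y : ℕ} (hy : y < 2 ^ w) : z = BitVec.ofNat w y ↔ z.toNat = y := by
  constructor
  · rintro rfl
    rw [BitVec.toNat_ofNat, Nat.mod_eq_of_lt hy]
  · rintro rfl
    simp

/-- The memory after adding the `k` words at `X`, shifted right by `r` bits, to the words at `Y`. -/
def shiftXor (r r' X Y k : ℕ) (mem : BitVec w → BitVec w) (z : BitVec w) : BitVec w :=
  if Y ≤ z.toNat ∧ z.toNat < Y + k then
    mem z ^^^ (mem (BitVec.ofNat w (X + (z.toNat - Y))) >>> r) ^^^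
      (if z.toNat - Y + 1 < k then mem (BitVec.ofNat w (X + (z.toNat - Y) + 1)) <<< r' else 0#w)
  else mem z

/-- Induction peels off the first word. As the two windows are disjoint, the words still to be read
are not affected by the words already written. -/
theorem reaches_xor_loop (k : ℕ) (σ : State w) (X Y : ℕ) (h : σ.pc = 18) (hk : 0 < k)
    (hX : X + k ≤ 2 ^ w) (hY : Y + k ≤ 2 ^ w) (hXY : X + k ≤ Y ∨ Y + k ≤ X)
    (h0 : σ.reg 0 = BitVec.ofNat w X) (h1 : σ.reg 1 = BitVec.ofNat w Y)
    (h2 : σ.reg 2 = BitVec.ofNat w k) (hk' : k < 2 ^ w) (h4 : σ.reg 4 = BitVec.ofNat w 1) :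
    ∃ t τ, t ≤ 15 * k ∧ Reaches rowAdditionProgram σ t τ ∧ τ.pc = 33 ∧
      τ.mem = shiftXor (σ.reg 6).toNat (σ.reg 3).toNat X Y k σ.mem := by
  induction k generalizing σ X Y with
  | zero => omega
  | succ k ih =>
    rcases Nat.eq_zero_or_pos k with rfl | hkpos
    · obtain ⟨τ, hr, hpc, hm⟩ := reaches_xor_last σ h h2 h4
      refine ⟨8, τ, by omega, hr, hpc, hm.trans ?_⟩
      funext z
      rw [h1, h0, Function.update_apply, shiftXor]
      by_cases hz : z = BitVec.ofNat w Y
      · have hzY := (eq_ofNat_iff (by omega)).1 hz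
        rw [if_pos hz, if_pos (by omega), if_neg (by omega), hzY, Nat.sub_self, hz]
        simp
      · have hzY : z.toNat ≠ Y := fun hh => hz ((eq_ofNat_iff (by omega)).2 hh)
        rw [if_neg hz, if_neg (by omega)]
    · have hone : 1 < 2 ^ w := by omega
      obtain ⟨τ, hr, hpc, r0, r1, r2, r3, r4, r6, hm⟩ := reaches_xor_word σ h
        (by rw [h2]; exact ofNat_ne_ofNat hk' hone (by omega)) h4
        (by rw [h0, h1, ofNat_add_one]; exact ofNat_ne_ofNat (by omega) (by omega) (by omega))
      obtain ⟨t, υ, ht, hr', hpc', hm'⟩ := ih τ (X + 1) (Y + 1) hpc hkpos (by omega) (by omega)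
        (by omega) (by rw [r0, h0, ofNat_add_one]) (by rw [r1, h1, ofNat_add_one])
        (by rw [r2, h2, ← ofNat_add_one, BitVec.add_sub_cancel]) (by omega) (r4.trans h4)
      refine ⟨15 + t, υ, by omega, hr.trans hr', hpc', hm'.trans ?_⟩
      rw [r6, r3, hm, h0, h1, ofNat_add_one]
      funext z
      have hoff : ∀ x, x < 2 ^ w → x ≠ Y → ∀ v, Function.update σ.mem (BitVec.ofNat w Y) v
          (BitVec.ofNat w x) = σ.mem (BitVec.ofNat w x) := fun x hx hxY v =>
        Function.update_of_ne (ofNat_ne_ofNat hx (by omega) hxY) _ _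
      by_cases hz : z = BitVec.ofNat w Y
      · have hzY := (eq_ofNat_iff (by omega)).1 hz
        rw [shiftXor, shiftXor, if_neg (by omega), if_pos (by omega), if_pos (by omega), hzY,
          Nat.sub_self, hz, Function.update_self]
        simp only [Nat.add_zero]
      · have hzY : z.toNat ≠ Y := fun hh => hz ((eq_ofNat_iff (by omega)).2 hh)
        rw [shiftXor, shiftXor]
        by_cases hin : Y ≤ z.toNat ∧ z.toNat < Y + (k + 1)
        · rw [if_pos (by omega), if_pos hin, Function.update_of_ne hz, hoff _ (by omega) (by omega)]
          have e1 : X + 1 + (z.toNat - (Y + 1)) = X + (z.toNat - Y) := by omega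
          rw [e1]
          by_cases hlast : z.toNat - Y + 1 < k + 1
          · rw [if_pos (by omega), if_pos hlast, hoff _ (by omega) (by omega)]
          · rw [if_neg (by omega), if_neg hlast]
        · rw [if_neg (by omega), if_neg hin, Function.update_of_ne hz]

end Program

end WordRAM

namespace WordRAM

/-! ### Correctness of the row addition program -/

theorem ofNat_val_xor {w : ℕ} (x y : ZMod 2) :
    BitVec.ofNat w x.val ^^^ BitVec.ofNat w y.val = BitVec.ofNat w (x + y).val := by
  have h : ∀ x : ZMod 2, x = 0 ∨ x = 1 := by decide
  have h2 : (1 + 1 : ZMod 2) = 0 := by decide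
  rcases h x with rfl | rfl <;> rcases h y with rfl | rfl <;> simp [h2]

theorem le_blockWords_mul {L w : ℕ} (hw : 0 < w) : L ≤ blockWords L w * w := by
  have h1 := Nat.div_add_mod (L + w - 1) w
  have h2 := Nat.mod_lt (L + w - 1) hw
  rw [blockWords, mul_comm]
  omega

/-- The effect of the program on the memory: `r = d % w` and `q = d / w` for the distance `d` of
the two starting positions. -/
theorem exists_reaches_rowAddition {w B q r S D : ℕ} (hw : 0 < w) (σ : State w) (hpc : σ.pc = 0)
    (hS : S + (B + 2) ≤ 2 ^ w) (hD : D + (B + 2) ≤ 2 ^ w)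
    (hSD : S + (B + 2) ≤ D ∨ D + (B + 2) ≤ S)
    (h0 : σ.reg 0 = BitVec.ofNat w S) (h1 : σ.reg 1 = BitVec.ofNat w D)
    (h2 : σ.reg 2 = BitVec.ofNat w B) (h3 : σ.reg 3 = BitVec.ofNat w w)
    (hle : (σ.mem (BitVec.ofNat w S)).toNat ≤ (σ.mem (BitVec.ofNat w D)).toNat)
    (hq : ((σ.mem (BitVec.ofNat w D)).toNat - (σ.mem (BitVec.ofNat w S)).toNat) / w = q)
    (hr : ((σ.mem (BitVec.ofNat w D)).toNat - (σ.mem (BitVec.ofNat w S)).toNat) % w = r)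
    (hqB : q < B) :
    ∃ t τ, t ≤ 14 + 20 * B ∧ Reaches rowAdditionProgram σ t τ ∧ τ.pc = 33 ∧
      τ.mem = shiftXor r (w - r) (S + 2 + q) (D + 2) (B - q)
        (Function.update σ.mem (BitVec.ofNat w (D + 1))
          (σ.mem (BitVec.ofNat w (D + 1)) ^^^ σ.mem (BitVec.ofNat w (S + 1)))) := by
  obtain ⟨τ₁, hr₁, pc₁, a0, a1, a2, a3, a4, a6, am⟩ := reaches_prelude σ hpc
  rw [h0, ofNat_add_one, ofNat_add_one] at a0
  rw [h1, ofNat_add_one, ofNat_add_one] at a1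
  have hd : (τ₁.reg 6).toNat =
      (σ.mem (BitVec.ofNat w D)).toNat - (σ.mem (BitVec.ofNat w S)).toNat := by
    rw [a6, h0, h1, BitVec.toNat_sub_of_le (BitVec.le_def.2 hle)]
  obtain ⟨t₂, τ₂, ht₂, hr₂, pc₂, b0, b1, b2, b3, b4, b6, bm⟩ :=
    reaches_reduce_shift hw q τ₁ pc₁ (by rw [hd, hq]) (a3.trans h3) a4
  rw [a0, ← BitVec.ofNat_add] at b0
  rw [hd, hr] at b6
  have hsplit : BitVec.ofNat w B = BitVec.ofNat w (B - q) + BitVec.ofNat w q := by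
    rw [← BitVec.ofNat_add, Nat.sub_add_cancel hqB.le]
  have hrw : r < w := hr ▸ Nat.mod_lt _ hw
  have hwlt : w % 2 ^ w = w := Nat.mod_eq_of_lt Nat.lt_two_pow_self
  have hr3 : (τ₂.reg 3).toNat = w - r := by
    rw [b3, BitVec.toNat_sub_of_le]
    · rw [BitVec.toNat_ofNat, hwlt, b6]
    · rw [BitVec.le_def, BitVec.toNat_ofNat, hwlt, b6]
      exact hrw.le
  obtain ⟨t₃, τ₃, ht₃, hr₃, pc₃, cm⟩ := reaches_xor_loop (B - q) τ₂ (S + 2 + q) (D + 2) pc₂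
    (by omega) (by omega) (by omega) (by omega) b0 (b1.trans a1)
    (by rw [b2, a2, h2, hsplit, BitVec.add_sub_cancel]) (by omega) b4
  -- The total is at most 12 + (5q + 2) + 15(B - q), well within the claimed bound.
  refine ⟨12 + (t₂ + t₃), τ₃, by omega, hr₁.trans (hr₂.trans hr₃), pc₃, ?_⟩
  rw [cm, b6, hr3, bm, am, h0, h1, ofNat_add_one, ofNat_add_one]

/-- For r = 0 the left shift by the full word length yields zero, and the second case does not
occur. -/
theorem getLsbD_shifted_pair {w r t : ℕ} (hr : r < w) (ht : t < w) (x y : BitVec w) :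
    (x >>> r ^^^ y <<< (w - r)).getLsbD t =
      if r + t < w then x.getLsbD (r + t) else y.getLsbD (r + t - w) := by
  rw [BitVec.getLsbD_xor, BitVec.getLsbD_ushiftRight, BitVec.getLsbD_shiftLeft]
  split_ifs with h
  · have : t < w - r := by omega
    simp [this]
  · have h1 : ¬ t < w - r := by omega
    have h2 : t - (w - r) = r + t - w := by omega
    rw [BitVec.getLsbD_of_ge _ _ (not_lt.1 h)]
    simp [h1, h2, ht]

/-- Bit p of the target block and bit p + d of the source block stand for the same column, where d =
qw + r is the difference of the starts. So the source is read `q` words further on, shifted by `r`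
bits. -/
theorem performsRowAddition {w L m N : ℕ} {s : Fin m → ℕ} {e : SGauss.RowAddition m N}
    (hg : e.Good L s) {T : ℝ} (hT : 14 + 20 * (blockWords L w : ℝ) ≤ T) :
    PerformsRowAddition rowAdditionProgram w L s e T := by
  intro addr hlay σ hpc h0 h1 h2 h3 hst
  have hd := hg.shift_lt
  have hsd := hg.le
  have hw : 0 < w := by
    rcases Nat.eq_zero_or_pos w with rfl | h
    · have := hlay.fits e.src
      rw [pow_zero] at this
      omega
    · exact h
  have hBL : L ≤ blockWords L w * w := le_blockWords_mul hw
  have hS := hlay.fits e.src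
  have hD := hlay.fits e.dst
  obtain ⟨q, hq⟩ : ∃ q, (s e.dst - s e.src) / w = q := ⟨_, rfl⟩
  obtain ⟨r, hr⟩ : ∃ r, (s e.dst - s e.src) % w = r := ⟨_, rfl⟩
  have hqr : q * w + r = s e.dst - s e.src := by
    rw [mul_comm, ← hq, ← hr]; exact Nat.div_add_mod _ _
  have hrw : r < w := hr ▸ Nat.mod_lt _ hw
  have hqB : q < blockWords L w := by
    by_contra hh
    have := Nat.mul_le_mul_right w (not_lt.1 hh)
    omega
  obtain ⟨t, τ, ht, hrun, hpc', hm⟩ := exists_reaches_rowAddition (q := q) (r := r) hw σ hpc hS hD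
    (hlay.disjoint _ _ hg.ne) h0 h1 h2 h3 (by rw [hst.start, hst.start]; exact hsd)
    (by rw [hst.start, hst.start, hq])
    (by rw [hst.start, hst.start, hr]) hqB
  have hrhs : ∀ x, x < 2 ^ w → x ≠ addr e.dst + 1 →
      Function.update σ.mem (BitVec.ofNat w (addr e.dst + 1))
        (σ.mem (BitVec.ofNat w (addr e.dst + 1)) ^^^ σ.mem (BitVec.ofNat w (addr e.src + 1)))
        (BitVec.ofNat w x) = σ.mem (BitVec.ofNat w x) := fun x hx hne =>
    Function.update_of_ne (ofNat_ne_ofNat hx (by omega) hne) _ _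
  have hout : ∀ x, x < 2 ^ w → (x ≤ addr e.dst ∨ addr e.dst + (blockWords L w + 2) ≤ x) →
      τ.mem (BitVec.ofNat w x) = σ.mem (BitVec.ofNat w x) := by
    intro x hx hxd
    rw [hm, shiftXor, BitVec.toNat_ofNat, Nat.mod_eq_of_lt hx, if_neg (by omega),
      hrhs x hx (by omega)]
  have hother : ∀ i, i ≠ e.dst → ∀ x, addr i ≤ x → x < addr i + (blockWords L w + 2) →
      τ.mem (BitVec.ofNat w x) = σ.mem (BitVec.ofNat w x) := by
    intro i hi x hx1 hx2
    have hf := hlay.fits i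
    have hdis := hlay.disjoint i e.dst hi
    exact hout x (by omega) (by omega)
  refine ⟨t, τ, le_trans ?_ hT, ⟨hrun.1, hrun.2, hpc'.ge⟩, ⟨fun i => ?_, fun i => ?_, ?_⟩, ?_⟩
  · exact_mod_cast ht
  · rw [← hst.start i]
    by_cases hi : i = e.dst
    · subst hi
      rw [hout _ (by omega) (Or.inl le_rfl)]
    · rw [hother i hi _ le_rfl (by omega)]
  · by_cases hi : i = e.dst
    · subst hi
      rw [e.newb_dst, ← ofNat_val_xor, ← hst.rhs, ← hst.rhs, hm, shiftXor, BitVec.toNat_ofNat,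
        Nat.mod_eq_of_lt (by omega), if_neg (by omega), Function.update_self]
    · rw [hother i hi _ (by omega) (by omega), e.newb_of_ne hi, hst.rhs]
  · intro i k hk t ht
    by_cases hi : i = e.dst
    · subst hi
      rw [e.newA_dst]
      have hdis := hlay.disjoint _ _ hg.ne
      have hidx : ∀ k', k' < blockWords L w → ∀ t', t' < w → k' * w + t' = k * w + t + (s e.dst - s e.src) →
          ((σ.mem (BitVec.ofNat w (addr e.src + 2 + k'))).getLsbD t' = true ↔
            ∃ j : Fin N, (j : ℕ) = s e.dst + (k * w + t) ∧ e.A e.src j = 1) := by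
        intro k' hk' t' ht' heq
        rw [hst.block e.src k' hk' t' ht', heq]
        constructor
        · rintro ⟨-, j, hj, hA⟩
          exact ⟨j, by omega, hA⟩
        · rintro ⟨j, hj, hA⟩
          have := (hg.block e.src j (by rw [hA]; exact one_ne_zero)).2
          exact ⟨by omega, j, by omega, hA⟩
      -- Positions past the last source word lie beyond the source block, so zeros are the right
      -- values there.
      have hnone : blockWords L w * w ≤ k * w + t + (s e.dst - s e.src) →
          ¬ ∃ j : Fin N, (j : ℕ) = s e.dst + (k * w + t) ∧ e.A e.src j = 1 := by
        rintro hge ⟨j, hj, hA⟩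
        have := (hg.block e.src j (by rw [hA]; exact one_ne_zero)).2
        omega
      have hword : ∃ v : BitVec w, τ.mem (BitVec.ofNat w (addr e.dst + 2 + k)) =
          σ.mem (BitVec.ofNat w (addr e.dst + 2 + k)) ^^^ v ∧ (v.getLsbD t = true ↔
            ∃ j : Fin N, (j : ℕ) = s e.dst + (k * w + t) ∧ e.A e.src j = 1) := by
        rw [hm, shiftXor, BitVec.toNat_ofNat, Nat.mod_eq_of_lt (by omega),
          hrhs (addr e.dst + 2 + k) (by omega) (by omega), Nat.add_sub_cancel_left]
        by_cases hkq : k < blockWords L w - q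
        · rw [if_pos (by omega), hrhs (addr e.src + 2 + q + k) (by omega) (by omega), BitVec.xor_assoc]
          refine ⟨_, rfl, ?_⟩
          have hsplit : ∀ y : BitVec w, (if k + 1 < blockWords L w - q then y <<< (w - r) else 0#w) =
              (if k + 1 < blockWords L w - q then y else 0#w) <<< (w - r) := by
            intro y; split_ifs <;> simp
          rw [hsplit, getLsbD_shifted_pair hrw ht]
          split_ifs with hlt hnext
          · rw [Nat.add_assoc (addr e.src + 2)]
            refine hidx (q + k) (by omega) _ hlt ?_
            rw [← hqr]; ring
          · rw [hrhs (addr e.src + 2 + q + k + 1) (by omega) (by omega),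
              Nat.add_assoc (addr e.src + 2), Nat.add_assoc (addr e.src + 2)]
            refine hidx (q + k + 1) (by omega) _ (by omega) ?_
            have : (q + k + 1) * w = q * w + k * w + w := by ring
            omega
          · have hBq : blockWords L w = q + k + 1 := by omega
            have : (q + k + 1) * w = q * w + k * w + w := by ring
            simp only [BitVec.getLsbD_zero, Bool.false_eq_true, false_iff]
            exact hnone (by rw [hBq]; omega)
        · rw [if_neg (by omega)]
          refine ⟨0#w, by simp, ?_⟩
          simp only [BitVec.getLsbD_zero, Bool.false_eq_true, false_iff]
          have h5 : blockWords L w * w ≤ (q + k) * w := Nat.mul_le_mul_right w (by omega)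
          rw [add_mul] at h5
          exact hnone (by omega)
      obtain ⟨v, hv1, hv2⟩ := hword
      have hxor : ∀ x y : Bool, (x ^^ y) = true ↔ ¬ (x = true ↔ y = true) := by decide
      rw [hv1, BitVec.getLsbD_xor, hxor, hst.block e.dst k hk t ht, hv2]
      have hsum : ∀ x y : ZMod 2, x + y = 1 ↔ ¬ (x = 1 ↔ y = 1) := by decide
      by_cases hin : k * w + t < L
      · by_cases hex : ∃ j : Fin N, (j : ℕ) = s e.dst + (k * w + t)
        · obtain ⟨j, hj⟩ := hex
          have huniq : ∀ p : Fin N → Prop,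
              (∃ j' : Fin N, (j' : ℕ) = s e.dst + (k * w + t) ∧ p j') ↔ p j := by
            intro p
            constructor
            · rintro ⟨j', hj', hp⟩
              rwa [Fin.ext (hj'.trans hj.symm)] at hp
            · exact fun hp => ⟨j, hj, hp⟩
          rw [huniq, huniq, huniq, Pi.add_apply, hsum]
          simp only [hin, true_and]
        · have hno : ∀ p : Fin N → Prop,
              ¬ ∃ j' : Fin N, (j' : ℕ) = s e.dst + (k * w + t) ∧ p j' :=
            fun p ⟨j', hj', _⟩ => hex ⟨j', hj'⟩
          simp only [hno, and_false, not_true_eq_false]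
      -- The padding stays zero because the source block ends no later than the target block.
      · have hno : ¬ ∃ j : Fin N, (j : ℕ) = s e.dst + (k * w + t) ∧ e.A e.src j = 1 := by
          rintro ⟨j, hj, hA⟩
          have := (hg.mem_block j (by rw [hA]; exact one_ne_zero)).2
          omega
        simp only [hin, hno, false_and, not_true_eq_false]
    · rw [hother i hi _ (by omega) (by omega), e.newA_of_ne hi]
      exact hst.block i k hk t ht
  · intro x hx
    have := hout x.toNat x.isLt (by omega)
    simpa using this

end WordRAM

/-! ### Choice of the constants and the main theorem -/

theorem sq_mul_exp_neg_le {ε : ℝ} (h0 : 0 < ε) (h1 : ε < 1) {m n : ℕ} {L : ℝ} (hm : 0 < m)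
    (hlog : 1 ≤ Real.log m) (hn : (n : ℝ) ≤ (m : ℝ) ^ 2) (hL : 20 * (Real.log m / ε) ≤ L) :
    (n : ℝ) ^ 2 * Real.exp (-(ε / 2 * (L - 1))) ≤ 1 / m := by
  have hm' : (0 : ℝ) < m := Nat.cast_pos.2 hm
  -- The exponent is at least 10 log m - 1/2, more than the 5 log m needed to beat n² ≤ m⁴ and leave
  -- 1/m.
  have hexp : Real.exp (-(ε / 2 * (L - 1))) ≤ ((m : ℝ) ^ 5)⁻¹ := by
    have h2 : ((m : ℝ) ^ 5)⁻¹ = Real.exp (-(5 * Real.log m)) := by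
      rw [Real.exp_neg, show (5 : ℝ) = ((5 : ℕ) : ℝ) by norm_num, Real.exp_nat_mul,
        Real.exp_log hm']
    rw [h2]
    refine Real.exp_le_exp.2 (neg_le_neg ?_)
    have h3 : 20 * Real.log m ≤ ε * L := by
      have := mul_le_mul_of_nonneg_left hL h0.le
      refine le_trans (le_of_eq ?_) this
      field_simp
    nlinarith
  calc (n : ℝ) ^ 2 * Real.exp (-(ε / 2 * (L - 1)))
      ≤ ((m : ℝ) ^ 2) ^ 2 * ((m : ℝ) ^ 5)⁻¹ := by gcongr
    _ = 1 / (m : ℝ) := by field_simp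

theorem blockWords_le {ε c ℓ : ℝ} {L w : ℕ} (h0 : 0 < ε) (hc : 0 < c) (hℓ : 0 < ℓ)
    (hL : (L : ℝ) ≤ 21 * (ℓ / ε)) (hw : c * ℓ ≤ w) :
    (WordRAM.blockWords L w : ℝ) ≤ 21 / (c * ε) + 1 := by
  have hcl : 0 < c * ℓ := mul_pos hc hℓ
  have hw' : (0 : ℝ) < w := hcl.trans_le hw
  have hle : WordRAM.blockWords L w * w ≤ L + w :=
    (Nat.div_mul_le_self (L + w - 1) w).trans (Nat.sub_le _ _)
  have hle' : (WordRAM.blockWords L w : ℝ) * w ≤ L + w := by exact_mod_cast hle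
  have h2 : (WordRAM.blockWords L w : ℝ) ≤ L / w + 1 := by
    rw [div_add_one hw'.ne', le_div_iff₀ hw']
    exact hle'
  have h3 : (L : ℝ) / w ≤ 21 / (c * ε) := by
    calc (L : ℝ) / w ≤ 21 * (ℓ / ε) / (c * ℓ) := by gcongr
      _ = 21 / (c * ε) := by field_simp
  linarith

theorem theorem2 :
    ∃ (C : ℝ) (T : ℝ → ℝ) (P : WordRAM.Program), 0 < C ∧
      ∀ ε : ℝ, 0 < ε → ε < 1 →
        ∃ m₀ : ℕ, ∀ m : ℕ, m₀ ≤ m →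
          ∃ L : ℕ, 1 ≤ L ∧ (L : ℝ) ≤ C * (Real.log m / ε) ∧
            ∀ n : ℕ, m = ⌊(1 - ε) * (n : ℝ)⌋₊ →
              ∀ b : Fin m → ZMod 2,
                -- the run succeeds with high probability
                1 - C / (m : ℝ) ≤ SGauss.unifProb (fun ω : SGauss.Sample m n L =>
                  (SGauss.sgauss L (SGauss.starts ω) (SGauss.bandMatrix ω) b).isSome = true) ∧
                -- success means full row rank, and then a solution is returned
                (∀ ω : SGauss.Sample m n L,
                  ((SGauss.sgauss L (SGauss.starts ω) (SGauss.bandMatrix ω) b).isSome = true ↔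
                    (SGauss.bandMatrix ω).rank = m) ∧
                  ∀ z, SGauss.sgauss L (SGauss.starts ω) (SGauss.bandMatrix ω) b = some z →
                    Matrix.mulVec (SGauss.bandMatrix ω) z = b) ∧
                -- the expected number of row additions
                SGauss.unifExpect (fun ω : SGauss.Sample m n L =>
                  ((SGauss.rowAdditions L (SGauss.starts ω) (SGauss.bandMatrix ω) b).length : ℝ))
                    ≤ C * ((m : ℝ) / ε) ∧
                -- each row addition
                ∀ ω : SGauss.Sample m n L,
                  ∀ e ∈ SGauss.rowAdditions L (SGauss.starts ω) (SGauss.bandMatrix ω) b,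
                    -- rows stay inside their own blocks
                    (∀ i j, e.A i j ≠ 0 →
                      SGauss.sortedStarts (SGauss.starts ω) i ≤ (j : ℕ) ∧
                        (j : ℕ) < SGauss.sortedStarts (SGauss.starts ω) i + L) ∧
                    -- the addition only involves entries inside the block of the target row
                    (∀ j, e.A e.src j ≠ 0 →
                      SGauss.sortedStarts (SGauss.starts ω) e.dst ≤ (j : ℕ) ∧
                        (j : ℕ) < SGauss.sortedStarts (SGauss.starts ω) e.dst + L) ∧
                    -- it takes time `O(1/ε)` on a word RAM with words of `Ω(log m)` bits
                    (∀ c : ℝ, 0 < c → ∀ w : ℕ, c * Real.log m ≤ (w : ℝ) →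
                      WordRAM.PerformsRowAddition P w L (SGauss.sortedStarts (SGauss.starts ω)) e
                        (T c / ε)) := by
  -- The length is 20 log m / ε rounded up, hence 21. The time bound is 14 + 20(21/(cε) + 1). The
  -- threshold 3 gives log m ≥ 1; the threshold 2/(1-ε) gives n ≤ m², so `L` need not depend on `n`.
  refine ⟨21, fun c => 34 + 420 / c, WordRAM.rowAdditionProgram, by norm_num, fun ε h0 h1 =>
    ⟨max 3 ⌈2 / (1 - ε)⌉₊, fun m hm => ?_⟩⟩
  have hm3 : 3 ≤ m := (le_max_left _ _).trans hm
  have hm3' : (3 : ℝ) ≤ m := by exact_mod_cast hm3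
  have hmε : 2 / (1 - ε) ≤ (m : ℝ) := Nat.ceil_le.1 ((le_max_right _ _).trans hm)
  have hlog : 1 ≤ Real.log m := by
    rw [Real.le_log_iff_exp_le (by linarith)]
    have := Real.exp_one_lt_d9
    linarith
  have hlogε : 1 ≤ Real.log m / ε := by rw [le_div_iff₀ h0]; linarith
  have hL1 : 20 * (Real.log m / ε) ≤ (⌈20 * (Real.log m / ε)⌉₊ : ℝ) := Nat.le_ceil _
  have hL2 : (⌈20 * (Real.log m / ε)⌉₊ : ℝ) ≤ 21 * (Real.log m / ε) := by
    have := Nat.ceil_lt_add_one (a := 20 * (Real.log m / ε)) (by linarith)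
    linarith
  generalize ⌈20 * (Real.log m / ε)⌉₊ = L at hL1 hL2
  have hLpos : 1 ≤ L := by
    have : (1 : ℝ) ≤ L := by linarith
    exact_mod_cast this
  refine ⟨L, hLpos, hL2, fun n hmn b => ?_⟩
  have hn : 0 < n := by
    rcases Nat.eq_zero_or_pos n with rfl | h
    · simp at hmn; omega
    · exact h
  have : NeZero n := ⟨hn.ne'⟩
  have hmn1 : (m : ℝ) ≤ (1 - ε) * n := by
    rw [hmn]
    exact Nat.floor_le (mul_nonneg (by linarith) (Nat.cast_nonneg n))
  have hmn2 : (1 - ε) * n < m + 1 := by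
    rw [hmn]
    exact Nat.lt_floor_add_one _
  have hnm : (n : ℝ) ≤ (m : ℝ) ^ 2 := by
    have h3 : 2 ≤ m * (1 - ε) := (div_le_iff₀ (by linarith)).1 hmε
    have h4 : (1 - ε) * n ≤ (1 - ε) * (m : ℝ) ^ 2 := by nlinarith
    exact le_of_mul_le_mul_left h4 (by linarith)
  have hfail := (SGauss.unifProb_not_rowsIndep_le (m := m) (n := n) (L := L) h0 h1 hLpos hn
    hmn1).trans (sq_mul_exp_neg_le h0 h1 (by omega) hlog hnm hL1)
  have hm0 : (0 : ℝ) < m := by linarith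
  refine ⟨?_, fun ω => ⟨?_, fun z hz => ?_⟩, ?_, fun ω e he => ?_⟩
  · simp only [SGauss.isSome_sgauss_iff (SGauss.blockSupported_bandMatrix _)]
    rw [SGauss.unifProb_eq_one_sub]
    have : 1 / (m : ℝ) ≤ 21 / m := by gcongr; norm_num
    linarith
  · rw [SGauss.isSome_sgauss_iff (SGauss.blockSupported_bandMatrix ω),
      SGauss.rank_eq_iff_rowsIndep]
  · exact SGauss.mulVec_of_sgauss_eq_some (SGauss.blockSupported_bandMatrix ω) hz
  · refine (SGauss.unifExpect_length_rowAdditions_le h0 h1 hn hmn1 b).trans ?_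
    have h3 : (m : ℝ) ^ 2 * SGauss.unifProb
        (fun ω : SGauss.Sample m n L => ¬ SGauss.RowsIndep (SGauss.bandMatrix ω)) ≤ m := by
      calc _ ≤ (m : ℝ) ^ 2 * (1 / m) := by gcongr
        _ = m := by field_simp
    have h4 : (m : ℝ) ≤ m / ε := by
      rw [le_div_iff₀ h0]
      nlinarith
    linarith
  · have hg := SGauss.good_of_mem_rowAdditions (SGauss.blockSupported_bandMatrix ω) he
    refine ⟨hg.block, hg.mem_block, fun c hc w hw => WordRAM.performsRowAddition hg ?_⟩
    have h3 := blockWords_le h0 hc (by linarith) hL2 hw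
    have h4 : (34 + 420 / c) / ε = 34 / ε + 20 * (21 / (c * ε)) := by field_simp; ring
    have h5 : 34 ≤ 34 / ε := by rw [le_div_iff₀ h0]; linarith
    rw [h4]
    linarith
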